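/- Fix an integer $d\ge 2$. Let $\mathcal A$ be the C*-algebra of the two-sided quantum spin chain, i.e. the C*-inductive limit of the algebras $\bigotimes_{z\in\Lambda}M_d(\mathbb C)$ over the finite sets $\Lambda\subset\mathbb Z$, and let $\mathcal A_R$, $\mathcal A_L\subset\mathcal A$ be the subalgebras of the half-chains $[0,\infty)$ and $(-\infty,-1]$, so that $\mathcal A=\mathcal A_L\otimes\mathcal A_R$. For $Q\in M_d(\mathbb C)$ let $Q^{(j)}\in\mathcal A$ be the copy of $Q$ at the site $j$. Let $\gamma$ be the $*$-automorphism of $\mathcal A$ with $\gamma(Q^{(j)})=Q^{(-j-1)}$ for all $Q$ and $j$ (the reflection), and let $\gamma_{R\to L}:\mathcal A_R\to\mathcal A_L$ and $\gamma_{L\to R}:\mathcal A_L\to\mathcal A_R$ be the $*$-isomorphisms obtained by restricting $\gamma$. A state $\omega$ on $\mathcal A$ is reflection invariant if $\omega\circ\gamma=\omega$. A pure state $\omega$ on $\mathcal A$ has the split property (with respect to $\mathcal A_L$ and $\mathcal A_R$) if, for the GNS representation $\pi_R$ of $\omega|_{\mathcal A_R}$, the von Neumann algebra $\pi_R(\mathcal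 A_R)''$ is a type I factor, i.e. $*$-isomorphic to $B(\mathcal K)$ for some Hilbert space $\mathcal K\ne 0$. Let $\omega$ be a reflection invariant pure state with the split property. A reflection-split representation of $\omega$ is a tuple $(\mathcal H,\pi,\Omega,\Gamma)$ where $(\mathcal H,\pi)$ is an irreducible representation of $\mathcal A_R$, $\Omega$ is a unit vector of $\mathcal H\otimes\mathcal H$ such that, with $\hat\pi:=(\pi\circ\gamma_{L\to R})\otimes\pi$, the triple $(\mathcal H\otimes\mathcal H,\hat\pi,\Omega)$ is a GNS triple of $\omega$, and $\Gamma$ is the unitary on $\mathcal H\otimes\mathcal H$ with $\Gamma\hat\pi(A)\Omega=\hat\pi(\gamma(A))\Omega$ for all $A\in\mathcal A$. The index $\sigma_\omega$ is the number in $\{1,-1\}$ such that $\Gamma(\xi\otimes\eta)=\sigma_\omega\,\eta\otimes\xi$ for all $\xi,\eta\in\mathcal H$, for every reflection-split representation of $\omega$. Theorem 2.9. Let $\omega_0$ and $\omega_1$ be reflection invariant pure states on $\mathcal A$ with the split property. Suppose that $\omega_1=\omega_0\circ\alpha$ for an automorphism $\alpha$ of $\mathcal A$ that allows a reflection invariant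 decomposition $(\alpha_R,W)$; that is, $\alpha_R$ is an automorphism of $\mathcal A_R$, $W$ is a unitary of $\mathcal A$, and $$\tilde\alpha^{-1}\circ\alpha=\mathrm{Ad}(W),\qquad \gamma(W)=W,\qquad\text{where}\quad \tilde\alpha:=(\gamma_{R\to L}\circ\alpha_R\circ\gamma_{L\to R})\otimes\alpha_R$$ and $\mathrm{Ad}(W)(A)=WAW^*$. Then the indices $\sigma_{\omega_0}$ and $\sigma_{\omega_1}$ are well defined (each of the two states has a reflection-split representation, and all of its reflection-split representations have the same sign), and $\sigma_{\omega_0}=\sigma_{\omega_1}$. -/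

import Mathlib

open scoped TensorProduct ComplexOrder InnerProductSpace ENNReal

universe u v

namespace SpinChain

/-! ### Observables of the two-sided chain

The algebra of a region `S ⊆ ℤ` is the C*-inductive limit of the matrix algebras `⨂_{z ∈ Λ} M_d`
over the finite sets `Λ ⊆ S`. It is built here as the norm closure of the *-algebra generated by the
one-site observables `Q^{(j)}` (`j ∈ S`, `Q ∈ M_d`) acting on `ℓ²` of the set of all configurations
`ℤ → Fin d`. For a finite set `Λ` this space is `(⨂_{z ∈ Λ} ℂ^d) ⊗ ℓ²(configurations off Λ)` and
the observables of `Λ` act on the first factor, so that they carry the operator norm of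
`⨂_{z ∈ Λ} ℂ^d`, and the closure is the inductive limit. -/

theorem sum_partialShift_le {ι : Type*} (P : ι → Prop) [DecidablePred P] (φ : ι → ι)
    (hφ : Set.InjOn φ {s | P s}) (f : lp (fun _ : ι => ℂ) 2) (t : Finset ι) :
    ∑ s ∈ t, ‖(if P s then f (φ s) else 0 : ℂ)‖ ^ (2 : ℝ≥0∞).toReal
      ≤ ‖f‖ ^ (2 : ℝ≥0∞).toReal := by
  classical
  have h2 : 0 < (2 : ℝ≥0∞).toReal := by norm_num
  calc ∑ s ∈ t, ‖(if P s then f (φ s) else 0 : ℂ)‖ ^ (2 : ℝ≥0∞).toReal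
      = ∑ s ∈ t with P s, ‖f (φ s)‖ ^ (2 : ℝ≥0∞).toReal := by
        rw [Finset.sum_filter]
        refine Finset.sum_congr rfl fun s _ => ?_
        split_ifs <;> simp
    _ = ∑ s ∈ (t.filter P).image φ, ‖f s‖ ^ (2 : ℝ≥0∞).toReal := by
        rw [Finset.sum_image]
        intro a ha b hb h
        exact hφ (by simpa using (Finset.mem_filter.1 ha).2)
          (by simpa using (Finset.mem_filter.1 hb).2) h
    _ ≤ ‖f‖ ^ (2 : ℝ≥0∞).toReal := lp.sum_rpow_le_norm_rpow h2 f _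

/-- The partial permutation operator `(T f) s = f (φ s)` if `P s` holds, and `0` otherwise, where
`φ` is injective on `P`. -/
noncomputable def partialShift {ι : Type*} (P : ι → Prop) [DecidablePred P] (φ : ι → ι)
    (hφ : Set.InjOn φ {s | P s}) : lp (fun _ : ι => ℂ) 2 →L[ℂ] lp (fun _ : ι => ℂ) 2 :=
  LinearMap.mkContinuous
    { toFun := fun f => ⟨fun s => if P s then f (φ s) else 0,
        memℓp_gen' fun t => sum_partialShift_le P φ hφ f t⟩
      map_add' := fun f g => by
        ext s
        change (if P s then f (φ s) + g (φ s) else 0) =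
          (if P s then f (φ s) else 0) + (if P s then g (φ s) else 0)
        split_ifs <;> simp
      map_smul' := fun c f => by
        ext s
        change (if P s then c * f (φ s) else 0) = c * (if P s then f (φ s) else 0)
        split_ifs <;> simp }
    1 fun f => by
      rw [one_mul]
      exact lp.norm_le_of_forall_sum_le (by norm_num) (norm_nonneg f)
        fun t => sum_partialShift_le P φ hφ f t

theorem partialShift_apply {ι : Type*} (P : ι → Prop) [DecidablePred P] (φ : ι → ι)
    (hφ : Set.InjOn φ {s | P s}) (f : lp (fun _ : ι => ℂ) 2) (s : ι) :
    partialShift P φ hφ f s = if P s then f (φ s) else 0 := rfl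

/-- Configurations: an index in `Fin d` (a vector of the standard basis of `ℂ^d`) at every site. -/
abbrev Config (d : ℕ) : Type := ℤ → Fin d

/-- The Hilbert space `ℓ²(ℤ → Fin d)`. -/
abbrev ConfigSpace (d : ℕ) : Type := lp (fun _ : Config d => ℂ) 2

/-- The matrix unit `e_{μ,ν}` at the site `j`: the configuration vector of `s` is sent to that of
`s` with `s j` replaced by `μ` if `s j = ν`, and to `0` otherwise. -/
noncomputable def matrixUnit {d : ℕ} (j : ℤ) (μ ν : Fin d) :
    ConfigSpace d →L[ℂ] ConfigSpace d :=
  partialShift (fun s : Config d => s j = μ) (fun s => Function.update s j ν) (by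
    intro s hs t ht h
    funext k
    by_cases hk : k = j
    · subst hk; exact (show s k = μ from hs).trans (show t k = μ from ht).symm
    · simpa [hk] using congrFun h k)

theorem matrixUnit_apply {d : ℕ} (j : ℤ) (μ ν : Fin d) (f : ConfigSpace d) (s : Config d) :
    matrixUnit j μ ν f s = if s j = μ then f (Function.update s j ν) else 0 := rfl

/-- The one-site observable `Q^{(j)}`: the matrix `Q` at the site `j`, the unit elsewhere. -/
noncomputable def site {d : ℕ} (j : ℤ) (Q : Matrix (Fin d) (Fin d) ℂ) :
    ConfigSpace d →L[ℂ] ConfigSpace d :=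
  ∑ μ, ∑ ν, Q μ ν • matrixUnit j μ ν

theorem site_apply {d : ℕ} (j : ℤ) (Q : Matrix (Fin d) (Fin d) ℂ) (f : ConfigSpace d)
    (s : Config d) : site j Q f s = ∑ ν, Q (s j) ν * f (Function.update s j ν) := by
  let ev : ConfigSpace d →ₗ[ℂ] ℂ :=
    { toFun := fun g => g s, map_add' := fun _ _ => rfl, map_smul' := fun _ _ => rfl }
  have h : site j Q f s = ∑ μ, ∑ ν, Q μ ν * matrixUnit j μ ν f s := by
    change ev (site j Q f) = ∑ μ, ∑ ν, Q μ ν * ev (matrixUnit j μ ν f)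
    simp [site, map_sum]
  rw [h, Finset.sum_eq_single (s j)]
  · simp [matrixUnit_apply]
  · intro μ _ hμ
    simp [matrixUnit_apply, hμ.symm]
  · simp

/-- The C*-algebra of the region `S ⊆ ℤ`, as a closed *-subalgebra of the bounded operators. -/
noncomputable def regionAlg (d : ℕ) (S : Set ℤ) :
    StarSubalgebra ℂ (ConfigSpace d →L[ℂ] ConfigSpace d) :=
  (StarAlgebra.adjoin ℂ
    {T | ∃ j ∈ S, ∃ Q : Matrix (Fin d) (Fin d) ℂ, T = site j Q}).topologicalClosure

theorem site_mem {d : ℕ} {S : Set ℤ} {j : ℤ} (hj : j ∈ S) (Q : Matrix (Fin d) (Fin d) ℂ) :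
    site j Q ∈ regionAlg d S :=
  StarSubalgebra.le_topologicalClosure _ (StarAlgebra.subset_adjoin ℂ _ ⟨j, hj, Q, rfl⟩)

theorem regionAlg_mono {d : ℕ} {S T : Set ℤ} (h : S ⊆ T) : regionAlg d S ≤ regionAlg d T :=
  StarSubalgebra.topologicalClosure_mono (StarAlgebra.adjoin_mono
    fun _ ⟨j, hj, Q, hQ⟩ => ⟨j, h hj, Q, hQ⟩)

/-- The quasi-local algebra `𝒜` of the two-sided chain. -/
abbrev Chain (d : ℕ) : Type := regionAlg d Set.univ

/-- The algebra `𝒜_R` of the half-infinite chain `[0, ∞)`. -/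
abbrev RightChain (d : ℕ) : Type := regionAlg d {j | 0 ≤ j}

/-- The algebra `𝒜_L` of the half-infinite chain `(-∞, -1]`. -/
abbrev LeftChain (d : ℕ) : Type := regionAlg d {j | j ≤ -1}

/-- The inclusion `𝒜_R ⊆ 𝒜`, that is `b ↦ 1 ⊗ b`. -/
noncomputable def inclR {d : ℕ} : RightChain d →⋆ₐ[ℂ] Chain d :=
  StarSubalgebra.inclusion (regionAlg_mono (Set.subset_univ _))

/-- The inclusion `𝒜_L ⊆ 𝒜`, that is `a ↦ a ⊗ 1`. -/
noncomputable def inclL {d : ℕ} : LeftChain d →⋆ₐ[ℂ] Chain d :=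
  StarSubalgebra.inclusion (regionAlg_mono (Set.subset_univ _))

/-! ### The reflection -/

/-- The configuration reflected by `j ↦ -j - 1`. -/
def reflectConfig {d : ℕ} (s : Config d) : Config d := fun j => s (-j - 1)

theorem reflectConfig_reflectConfig {d : ℕ} (s : Config d) :
    reflectConfig (reflectConfig s) = s := by
  funext j
  simp [reflectConfig]

/-- The operator on `ℓ²` that reflects configurations. -/
noncomputable def reflectionOp (d : ℕ) : ConfigSpace d →L[ℂ] ConfigSpace d :=
  partialShift (fun _ => True) reflectConfig
    (Function.LeftInverse.injective reflectConfig_reflectConfig).injOn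

theorem reflectionOp_apply {d : ℕ} (f : ConfigSpace d) (s : Config d) :
    reflectionOp d f s = f (reflectConfig s) := by
  change (if True then f (reflectConfig s) else 0) = _
  exact if_pos trivial

theorem reflectionOp_reflectionOp {d : ℕ} (f : ConfigSpace d) :
    reflectionOp d (reflectionOp d f) = f := by
  ext s
  simp [reflectionOp_apply, reflectConfig_reflectConfig]

theorem norm_reflectionOp_le {d : ℕ} (f : ConfigSpace d) : ‖reflectionOp d f‖ ≤ ‖f‖ :=
  lp.norm_le_of_forall_sum_le (by norm_num) (norm_nonneg f)
    fun t => sum_partialShift_le (fun _ => True) reflectConfig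
      (Function.LeftInverse.injective reflectConfig_reflectConfig).injOn f t

/-- The unitary on `ℓ²` that reflects configurations. -/
noncomputable def reflectionUnitary (d : ℕ) : ConfigSpace d ≃ₗᵢ[ℂ] ConfigSpace d where
  toFun := reflectionOp d
  invFun := reflectionOp d
  map_add' := map_add _
  map_smul' := map_smul _
  left_inv := reflectionOp_reflectionOp
  right_inv := reflectionOp_reflectionOp
  norm_map' f := le_antisymm (norm_reflectionOp_le f) (by
    conv_lhs => rw [← reflectionOp_reflectionOp f]
    exact norm_reflectionOp_le _)

/-- Conjugation by the reflection unitary. -/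
noncomputable def reflectionAd (d : ℕ) :
    (ConfigSpace d →L[ℂ] ConfigSpace d) ≃⋆ₐ[ℂ] (ConfigSpace d →L[ℂ] ConfigSpace d) :=
  (reflectionUnitary d).conjStarAlgEquiv

theorem reflectionAd_reflectionAd {d : ℕ} (T : ConfigSpace d →L[ℂ] ConfigSpace d) :
    reflectionAd d (reflectionAd d T) = T :=
  (reflectionAd d).symm_apply_apply T

theorem reflectionAd_site {d : ℕ} (j : ℤ) (Q : Matrix (Fin d) (Fin d) ℂ) :
    reflectionAd d (site j Q) = site (-j - 1) Q := by
  ext f s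
  change reflectionOp d (site j Q (reflectionOp d f)) s = _
  simp only [reflectionOp_apply, site_apply]
  refine Finset.sum_congr rfl fun ν _ => ?_
  have hs : reflectConfig (Function.update (reflectConfig s) j ν)
      = Function.update s (-j - 1) ν := ?_
  · rw [hs]; rfl
  funext k
  by_cases hk : k = -j - 1
  · subst hk; simp [reflectConfig]
  · have : -k - 1 ≠ j := by omega
    simp [reflectConfig, hk, this]

theorem continuous_reflectionAd (d : ℕ) : Continuous (reflectionAd d) := by
  exact (reflectionUnitary d).toContinuousLinearEquiv.conjContinuousAlgEquiv.continuous

theorem reflectionAd_mem {d : ℕ} {S T : Set ℤ} (h : ∀ j ∈ S, -j - 1 ∈ T)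
    {x : ConfigSpace d →L[ℂ] ConfigSpace d} (hx : x ∈ regionAlg d S) :
    reflectionAd d x ∈ regionAlg d T := by
  let F : (ConfigSpace d →L[ℂ] ConfigSpace d) →⋆ₐ[ℂ] (ConfigSpace d →L[ℂ] ConfigSpace d) :=
    (reflectionAd d : _ →⋆ₐ[ℂ] _)
  have h1 : StarAlgebra.adjoin ℂ {T | ∃ j ∈ S, ∃ Q : Matrix (Fin d) (Fin d) ℂ, T = site j Q}
      ≤ (regionAlg d T).comap F := by
    refine StarAlgebra.adjoin_le ?_
    rintro _ ⟨j, hj, Q, rfl⟩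
    change reflectionAd d (site j Q) ∈ regionAlg d T
    rw [reflectionAd_site]
    exact site_mem (h j hj) Q
  exact StarSubalgebra.topologicalClosure_minimal h1
    ((StarSubalgebra.isClosed_topologicalClosure _).preimage (continuous_reflectionAd d)) hx

/-- The *-isomorphism between two *-subalgebras `S`, `T` obtained by restricting a *-isomorphism `e`
that maps `S` onto `T`. -/
def restrictIso {B C : Type*} [Ring B] [StarRing B] [Algebra ℂ B] [StarModule ℂ B]
    [Ring C] [StarRing C] [Algebra ℂ C] [StarModule ℂ C] (e : B ≃⋆ₐ[ℂ] C)
    (S : StarSubalgebra ℂ B) (T : StarSubalgebra ℂ C)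
    (h : ∀ x ∈ S, e x ∈ T) (h' : ∀ y ∈ T, e.symm y ∈ S) : S ≃⋆ₐ[ℂ] T where
  toFun x := ⟨e x, h x x.2⟩
  invFun y := ⟨e.symm y, h' y y.2⟩
  left_inv x := Subtype.ext (e.symm_apply_apply x)
  right_inv y := Subtype.ext (e.apply_symm_apply y)
  map_mul' _ _ := Subtype.ext (map_mul e _ _)
  map_add' _ _ := Subtype.ext (map_add e _ _)
  map_star' _ := Subtype.ext (map_star e _)
  map_smul' _ _ := Subtype.ext (map_smul e _ _)

theorem coe_restrictIso {B C : Type*} [Ring B] [StarRing B] [Algebra ℂ B] [StarModule ℂ B]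
    [Ring C] [StarRing C] [Algebra ℂ C] [StarModule ℂ C] (e : B ≃⋆ₐ[ℂ] C)
    (S : StarSubalgebra ℂ B) (T : StarSubalgebra ℂ C)
    (h : ∀ x ∈ S, e x ∈ T) (h' : ∀ y ∈ T, e.symm y ∈ S) (x : S) :
    (restrictIso e S T h h' x : C) = e x := rfl

theorem restrictIso_inclusion {B C : Type*} [Ring B] [StarRing B] [Algebra ℂ B] [StarModule ℂ B]
    [Ring C] [StarRing C] [Algebra ℂ C] [StarModule ℂ C] (e : B ≃⋆ₐ[ℂ] C)
    {S S' : StarSubalgebra ℂ B} {T T' : StarSubalgebra ℂ C} (hS : S ≤ S') (hT : T ≤ T')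
    (h : ∀ x ∈ S, e x ∈ T) (h' : ∀ y ∈ T, e.symm y ∈ S)
    (k : ∀ x ∈ S', e x ∈ T') (k' : ∀ y ∈ T', e.symm y ∈ S') (x : S) :
    restrictIso e S' T' k k' (StarSubalgebra.inclusion hS x)
      = StarSubalgebra.inclusion hT (restrictIso e S T h h' x) := rfl

/-- The restriction of the conjugation by the reflection unitary to the algebras of two regions that
are reflections of each other. -/
noncomputable def reflectIso {d : ℕ} (S T : Set ℤ) (h : ∀ j ∈ S, -j - 1 ∈ T)
    (h' : ∀ j ∈ T, -j - 1 ∈ S) : regionAlg d S ≃⋆ₐ[ℂ] regionAlg d T :=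
  restrictIso (reflectionAd d) (regionAlg d S) (regionAlg d T)
    (fun _ hx => reflectionAd_mem h hx) (fun _ hy => reflectionAd_mem h' hy)

theorem coe_reflectIso {d : ℕ} (S T : Set ℤ) (h : ∀ j ∈ S, -j - 1 ∈ T)
    (h' : ∀ j ∈ T, -j - 1 ∈ S) (x : regionAlg d S) :
    ((reflectIso S T h h' x : regionAlg d T) : ConfigSpace d →L[ℂ] ConfigSpace d)
      = reflectionAd d x :=
  coe_restrictIso _ _ _ _ _ x

theorem reflectIso_inclusion {d : ℕ} {S S' T T' : Set ℤ} (hS : S ⊆ S') (hT : T ⊆ T')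
    (h : ∀ j ∈ S, -j - 1 ∈ T) (h' : ∀ j ∈ T, -j - 1 ∈ S)
    (k : ∀ j ∈ S', -j - 1 ∈ T') (k' : ∀ j ∈ T', -j - 1 ∈ S') (x : regionAlg d S) :
    reflectIso S' T' k k' (StarSubalgebra.inclusion (regionAlg_mono hS) x)
      = StarSubalgebra.inclusion (regionAlg_mono hT) (reflectIso S T h h' x) :=
  restrictIso_inclusion (reflectionAd d) _ _ _ _ _ _ x

theorem reflect_right {j : ℤ} (hj : j ∈ {j : ℤ | 0 ≤ j}) : -j - 1 ∈ {j : ℤ | j ≤ -1} := by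
  simp only [Set.mem_ofPred_eq] at hj ⊢
  omega

theorem reflect_left {j : ℤ} (hj : j ∈ {j : ℤ | j ≤ -1}) : -j - 1 ∈ {j : ℤ | 0 ≤ j} := by
  simp only [Set.mem_ofPred_eq] at hj ⊢
  omega

/-- The reflection `γ`, the *-automorphism of `𝒜` with `γ(Q^{(j)}) = Q^{(-j-1)}`. -/
noncomputable def γ (d : ℕ) : Chain d ≃⋆ₐ[ℂ] Chain d :=
  reflectIso Set.univ Set.univ (fun _ _ => Set.mem_univ _) (fun _ _ => Set.mem_univ _)

/-- The *-isomorphism `γ_{R→L} : 𝒜_R → 𝒜_L` induced by `γ`. -/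
noncomputable def γRL (d : ℕ) : RightChain d ≃⋆ₐ[ℂ] LeftChain d :=
  reflectIso _ _ (fun _ => reflect_right) (fun _ => reflect_left)

/-- The *-isomorphism `γ_{L→R} : 𝒜_L → 𝒜_R` induced by `γ`. -/
noncomputable def γLR (d : ℕ) : LeftChain d ≃⋆ₐ[ℂ] RightChain d :=
  reflectIso _ _ (fun _ => reflect_left) (fun _ => reflect_right)

theorem γ_site {d : ℕ} (j : ℤ) (Q : Matrix (Fin d) (Fin d) ℂ) :
    γ d ⟨site j Q, site_mem (Set.mem_univ j) Q⟩
      = ⟨site (-j - 1) Q, site_mem (Set.mem_univ (-j - 1)) Q⟩ :=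
  Subtype.ext ((coe_reflectIso _ _ _ _ _).trans (reflectionAd_site j Q))

theorem γ_inclR {d : ℕ} (b : RightChain d) : γ d (inclR b) = inclL (γRL d b) :=
  reflectIso_inclusion (Set.subset_univ _) (Set.subset_univ _) (fun _ => reflect_right)
    (fun _ => reflect_left) (fun _ _ => Set.mem_univ _) (fun _ _ => Set.mem_univ _) b

theorem γ_inclL {d : ℕ} (a : LeftChain d) : γ d (inclL a) = inclR (γLR d a) :=
  reflectIso_inclusion (Set.subset_univ _) (Set.subset_univ _) (fun _ => reflect_left)
    (fun _ => reflect_right) (fun _ _ => Set.mem_univ _) (fun _ _ => Set.mem_univ _) a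

/-! ### States, representations, type I factors -/

/-- A state: a positive unital linear functional. -/
structure IsState {A : Type*} [Ring A] [StarRing A] [Algebra ℂ A] (φ : A →ₗ[ℂ] ℂ) : Prop where
  nonneg : ∀ a, 0 ≤ φ (star a * a)
  map_one : φ 1 = 1

/-- A pure state: an extreme point of the convex set of all states. -/
def IsPureState {A : Type*} [Ring A] [StarRing A] [Algebra ℂ A] (φ : A →ₗ[ℂ] ℂ) : Prop :=
  φ ∈ Set.extremePoints ℝ {ψ : A →ₗ[ℂ] ℂ | IsState ψ}

/-- `(H, π, Ω)` is a GNS triple of `φ`: `Ω` is cyclic for `π` and `φ(a) = ⟨Ω, π(a) Ω⟩`. -/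
structure IsGNSTriple {A : Type*} [Ring A] [StarRing A] [Algebra ℂ A]
    {H : Type*} [NormedAddCommGroup H] [InnerProductSpace ℂ H] [CompleteSpace H]
    (φ : A →ₗ[ℂ] ℂ) (π : A →⋆ₐ[ℂ] (H →L[ℂ] H)) (Ω : H) : Prop where
  cyclic : Dense (Set.range fun a => π a Ω)
  eq_inner : ∀ a, φ a = ⟪Ω, π a Ω⟫_ℂ

/-- A representation on a nonzero Hilbert space is irreducible if its only closed invariant
subspaces are `0` and the whole space. -/
def IsIrreducibleRep {A : Type*} [Ring A] [StarRing A] [Algebra ℂ A]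
    {H : Type*} [NormedAddCommGroup H] [InnerProductSpace ℂ H] [CompleteSpace H]
    (π : A →⋆ₐ[ℂ] (H →L[ℂ] H)) : Prop :=
  Nontrivial H ∧ ∀ K : Submodule ℂ H, IsClosed (K : Set H) →
    (∀ a, ∀ x ∈ K, π a x ∈ K) → K = ⊥ ∨ K = ⊤

/-- The von Neumann algebra `π(A)″` generated by a representation. -/
noncomputable def bicommutant {A : Type*} [Ring A] [StarRing A] [Algebra ℂ A]
    {H : Type*} [NormedAddCommGroup H] [InnerProductSpace ℂ H] [CompleteSpace H]
    (π : A →⋆ₐ[ℂ] (H →L[ℂ] H)) : VonNeumannAlgebra H where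
  toStarSubalgebra :=
    StarSubalgebra.centralizer ℂ (StarSubalgebra.centralizer ℂ (Set.range π) : Set (H →L[ℂ] H))
  centralizer_centralizer' :=
    Set.centralizer_centralizer_centralizer _

/-- A von Neumann algebra is a type I factor if it is *-isomorphic to the algebra of all bounded
operators on some nonzero Hilbert space. -/
def IsTypeIFactor {H : Type u} [NormedAddCommGroup H] [InnerProductSpace ℂ H] [CompleteSpace H]
    (M : VonNeumannAlgebra H) : Prop :=
  ∃ (K : Type u) (_ : NormedAddCommGroup K) (_ : InnerProductSpace ℂ K) (_ : CompleteSpace K),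
    Nontrivial K ∧ Nonempty (M.toStarSubalgebra ≃⋆ₐ[ℂ] (K →L[ℂ] K))

/-- The restriction of a functional on `𝒜` to `𝒜_R`. -/
noncomputable def restrictR {d : ℕ} (φ : Chain d →ₗ[ℂ] ℂ) : RightChain d →ₗ[ℂ] ℂ :=
  φ ∘ₗ (inclR : RightChain d →⋆ₐ[ℂ] Chain d).toAlgHom.toLinearMap

/-- The split property with respect to `𝒜_L` and `𝒜_R`: the von Neumann algebra generated by `𝒜_R`
in the GNS representation of `φ|_{𝒜_R}` is a type I factor. (The GNS triple is unique up to unitary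
equivalence, and can always be taken in the lowest universe.) -/
def HasSplitProperty {d : ℕ} (φ : Chain d →ₗ[ℂ] ℂ) : Prop :=
  ∃ (H : Type) (_ : NormedAddCommGroup H) (_ : InnerProductSpace ℂ H) (_ : CompleteSpace H)
    (π : RightChain d →⋆ₐ[ℂ] (H →L[ℂ] H)) (Ω : H),
    IsGNSTriple (restrictR φ) π Ω ∧ IsTypeIFactor (bicommutant π)

/-- A functional on `𝒜` is reflection invariant if `φ ∘ γ = φ`. -/
def IsReflectionInvariant {d : ℕ} (φ : Chain d →ₗ[ℂ] ℂ) : Prop :=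
  ∀ A, φ (γ d A) = φ A

/-! ### Reflection-split representations and the index -/

/-- The Hilbert space tensor product `H ⊗ K`. -/
abbrev HilbertTensor (H : Type u) (K : Type v) [NormedAddCommGroup H] [InnerProductSpace ℂ H]
    [NormedAddCommGroup K] [InnerProductSpace ℂ K] : Type (max u v) :=
  UniformSpace.Completion (H ⊗[ℂ] K)

/-- The simple tensor `ξ ⊗ η` in the Hilbert space tensor product. -/
noncomputable def hTmul {H : Type u} {K : Type v} [NormedAddCommGroup H] [InnerProductSpace ℂ H]
    [NormedAddCommGroup K] [InnerProductSpace ℂ K] (ξ : H) (η : K) : HilbertTensor H K :=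
  ((ξ ⊗ₜ[ℂ] η : H ⊗[ℂ] K) : UniformSpace.Completion (H ⊗[ℂ] K))

/-- `τ` is the representation `ρ ⊗ π` of `𝒜 = 𝒜_L ⊗ 𝒜_R` on `H ⊗ K`; it is determined by its values
on the products `a ⊗ b`, which span a dense subspace of `𝒜`. -/
def IsTensorRep {d : ℕ} {H : Type u} {K : Type v}
    [NormedAddCommGroup H] [InnerProductSpace ℂ H] [CompleteSpace H]
    [NormedAddCommGroup K] [InnerProductSpace ℂ K] [CompleteSpace K]
    (τ : Chain d →⋆ₐ[ℂ] (HilbertTensor H K →L[ℂ] HilbertTensor H K))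
    (ρ : LeftChain d →⋆ₐ[ℂ] (H →L[ℂ] H)) (π : RightChain d →⋆ₐ[ℂ] (K →L[ℂ] K)) : Prop :=
  ∀ a b ξ η, τ (inclL a * inclR b) (hTmul ξ η) = hTmul (ρ a ξ) (π b η)

/-- A reflection-split representation of `ω`: an irreducible representation `(H, π)` of `𝒜_R` and a
unit vector `Ω` of `H ⊗ H` such that `(H ⊗ H, (π ∘ γ_{L→R}) ⊗ π, Ω)` is a GNS triple of `ω`,
together with the unitary `Γ` on `H ⊗ H` (unique by cyclicity of `Ω`) which implements `γ` and
fixes `Ω`. The field `πhat` is the representation `(π ∘ γ_{L→R}) ⊗ π`. -/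
structure ReflectionSplitRep {d : ℕ} (ω : Chain d →ₗ[ℂ] ℂ) (H : Type u)
    [NormedAddCommGroup H] [InnerProductSpace ℂ H] [CompleteSpace H] where
  π : RightChain d →⋆ₐ[ℂ] (H →L[ℂ] H)
  πhat : Chain d →⋆ₐ[ℂ] (HilbertTensor H H →L[ℂ] HilbertTensor H H)
  Ω : HilbertTensor H H
  Γ : HilbertTensor H H ≃ₗᵢ[ℂ] HilbertTensor H H
  isTensorRep : IsTensorRep πhat (π.comp (γLR d).toStarAlgHom) π
  irreducible : IsIrreducibleRep π
  norm_Ω : ‖Ω‖ = 1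
  gns : IsGNSTriple ω πhat Ω
  Γ_apply : ∀ A, Γ (πhat A Ω) = πhat (γ d A) Ω

/-- The sign `σ = ±1` is read off from a reflection-split representation: `Γ(ξ ⊗ η) = σ η ⊗ ξ`. -/
def ReflectionSplitRep.HasSign {d : ℕ} {ω : Chain d →ₗ[ℂ] ℂ} {H : Type u}
    [NormedAddCommGroup H] [InnerProductSpace ℂ H] [CompleteSpace H]
    (r : ReflectionSplitRep ω H) (σ : ℤˣ) : Prop :=
  ∀ ξ η : H, r.Γ (hTmul ξ η) = ((σ : ℤ) : ℂ) • hTmul η ξ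

/-- `σ` is the index of `ω`: there are reflection-split representations of `ω`, and every one of
them has the sign `σ`. -/
def IsZ2Index {d : ℕ} (ω : Chain d →ₗ[ℂ] ℂ) (σ : ℤˣ) : Prop :=
  (∃ (H : Type) (_ : NormedAddCommGroup H) (_ : InnerProductSpace ℂ H) (_ : CompleteSpace H),
      Nonempty (ReflectionSplitRep ω H)) ∧
    ∀ (H : Type u) [NormedAddCommGroup H] [InnerProductSpace ℂ H] [CompleteSpace H]
      (r : ReflectionSplitRep ω H), r.HasSign σ

open scoped Classical in
/-- The index `σ_ω ∈ {1, -1}` (with the value `1` for a functional that has no index). -/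
noncomputable def z2Index {d : ℕ} (ω : Chain d →ₗ[ℂ] ℂ) : ℤˣ :=
  if h : ∃ σ, IsZ2Index.{0} ω σ then h.choose else 1

/-! ### Reflection invariant decompositions -/

/-- `δ` is the automorphism `α_L ⊗ α_R` of `𝒜 = 𝒜_L ⊗ 𝒜_R`; it is determined by its values on the
products `a ⊗ b`, which span a dense subspace of `𝒜`. -/
def IsTensorAut {d : ℕ} (δ : Chain d ≃⋆ₐ[ℂ] Chain d) (αL : LeftChain d ≃⋆ₐ[ℂ] LeftChain d)
    (αR : RightChain d ≃⋆ₐ[ℂ] RightChain d) : Prop :=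
  ∀ a b, δ (inclL a * inclR b) = inclL (αL a) * inclR (αR b)

/-- `(α_R, W)` is a reflection invariant decomposition of `α`: for the automorphism
`δ = (γ_{R→L} ∘ α_R ∘ γ_{L→R}) ⊗ α_R` one has `δ⁻¹ ∘ α = Ad(W)`, and `γ(W) = W`. -/
def IsReflectionInvariantDecomposition {d : ℕ} (α : Chain d ≃⋆ₐ[ℂ] Chain d)
    (αR : RightChain d ≃⋆ₐ[ℂ] RightChain d) (W : unitary (Chain d)) : Prop :=
  (∃ δ : Chain d ≃⋆ₐ[ℂ] Chain d,
      IsTensorAut δ (((γLR d).trans αR).trans (γRL d)) αR ∧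
      ∀ A, δ.symm (α A) = (W : Chain d) * A * star (W : Chain d)) ∧
    γ d (W : Chain d) = W

end SpinChain

namespace SpinChain

/-! ### Representations of *-algebras -/

/-! Everything rests on Schur's lemma, applied to the GNS representation of a pure state, which is
irreducible (`IsPureState.isIrreducibleRep`).

Existence. The split property identifies `π_R(A_R)″` with some `B(K)`, and this yields an
irreducible representation `π` of the right half-chain on `K` that sits inside the GNS space `G` of
`ω`. The unitary implementing the reflection carries this copy of `K` to a copy of `π ∘ γLR` for the
left half-chain. The two halves commute and act jointly irreducibly on `G`, so
`exists_tensor_unitary` gives `G ≅ K ⊗ K`.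

Sign. The reflection unitary `Γ` and the flip `F` of `K ⊗ K` implement the same automorphism `γ`, so
`Γ = cF` by Schur. Both are involutions, whence `c² = 1` (`exists_hasSign`). Two reflection-split
representations are related by a unitary `U` between the tensor products. A slice of `U` shows that
the half-chain representations are equivalent through some `u`, so that `U = c (u ⊗ u)`. Such a `U`
respects the flips, and the signs agree (`sign_unique`).

Invariance. Write `α = δ ∘ Ad W` with `δ` the tensor product automorphism. Composing a
representation of `ω₀` with `δ` (with `αR` on the half-chain) and replacing `Ω` by the vector `πhat
(δ W*) Ω` gives one of `ω₁`. Since `γ` commutes with `δ` and fixes `W`, the same `Γ` serves both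
(`exists_transport`), hence so does the sign. -/

theorem surjective_of_denseRange {H : Type*} [NormedAddCommGroup H] [InnerProductSpace ℂ H]
    [CompleteSpace H] {H' : Type*} [NormedAddCommGroup H'] [InnerProductSpace ℂ H']
    (V : H →ₗᵢ[ℂ] H') (h : DenseRange V) : Function.Surjective V := by
  have hc : IsClosed (Set.range V) := V.isometry.isClosedEmbedding.isClosed_range
  exact Set.range_eq_univ.1 (hc.closure_eq.symm.trans h.closure_range)

section Representations

variable {A : Type*} [Ring A] [StarRing A] [Algebra ℂ A]
  {H : Type*} [NormedAddCommGroup H] [InnerProductSpace ℂ H] [CompleteSpace H]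
  {H' : Type*} [NormedAddCommGroup H'] [InnerProductSpace ℂ H'] [CompleteSpace H']

theorem inner_star_rep (π : A →⋆ₐ[ℂ] (H →L[ℂ] H)) (a : A) (x y : H) :
    ⟪π (star a) x, y⟫_ℂ = ⟪x, π a y⟫_ℂ := by
  rw [map_star, ContinuousLinearMap.star_eq_adjoint, ContinuousLinearMap.adjoint_inner_left]

theorem inner_rep_left (π : A →⋆ₐ[ℂ] (H →L[ℂ] H)) (a : A) (x y : H) :
    ⟪π a x, y⟫_ℂ = ⟪x, π (star a) y⟫_ℂ := by
  rw [← inner_star_rep, star_star]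

theorem rep_mul_apply (π : A →⋆ₐ[ℂ] (H →L[ℂ] H)) (a b : A) (x : H) :
    π (a * b) x = π a (π b x) := by
  rw [map_mul]; rfl

theorem rep_one_apply (π : A →⋆ₐ[ℂ] (H →L[ℂ] H)) (x : H) : π 1 x = x := by
  rw [map_one]; rfl

/-- The linear map `a ↦ π(a) Ω`. -/
noncomputable def orbitMap (π : A →⋆ₐ[ℂ] (H →L[ℂ] H)) (Ω : H) : A →ₗ[ℂ] H where
  toFun a := π a Ω
  map_add' a b := by rw [map_add]; rfl
  map_smul' c a := by rw [map_smul]; rfl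

theorem orbitMap_apply (π : A →⋆ₐ[ℂ] (H →L[ℂ] H)) (Ω : H) (a : A) :
    orbitMap π Ω a = π a Ω := rfl

/-- Both squared norms equal `φ (a* a)`; this makes `π(a)Ω ↦ π'(a)Ω'` well defined and isometric. -/
theorem norm_rep_apply_eq {φ : A →ₗ[ℂ] ℂ} {π : A →⋆ₐ[ℂ] (H →L[ℂ] H)} {Ω : H}
    (h : ∀ a, φ a = ⟪Ω, π a Ω⟫_ℂ) {π' : A →⋆ₐ[ℂ] (H' →L[ℂ] H')} {Ω' : H'}
    (h' : ∀ a, φ a = ⟪Ω', π' a Ω'⟫_ℂ) (a : A) : ‖π' a Ω'‖ = ‖π a Ω‖ := by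
  have : ⟪π' a Ω', π' a Ω'⟫_ℂ = ⟪π a Ω, π a Ω⟫_ℂ := by
    rw [inner_rep_left, inner_rep_left, ← rep_mul_apply, ← rep_mul_apply, ← h, ← h']
  rw [@norm_eq_sqrt_re_inner ℂ, @norm_eq_sqrt_re_inner ℂ, this]

theorem IsGNSTriple.denseRange {φ : A →ₗ[ℂ] ℂ} {π : A →⋆ₐ[ℂ] (H →L[ℂ] H)} {Ω : H}
    (h : IsGNSTriple φ π Ω) : DenseRange (orbitMap π Ω) := h.cyclic

/-- The cyclic representation of `φ` embeds into every representation in which `φ` is a vector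
functional. -/
theorem IsGNSTriple.exists_isometry {φ : A →ₗ[ℂ] ℂ} {π : A →⋆ₐ[ℂ] (H →L[ℂ] H)} {Ω : H}
    (h : IsGNSTriple φ π Ω) {π' : A →⋆ₐ[ℂ] (H' →L[ℂ] H')} {Ω' : H'}
    (h' : ∀ a, φ a = ⟪Ω', π' a Ω'⟫_ℂ) :
    ∃ V : H →ₗᵢ[ℂ] H', (∀ a, V (π a Ω) = π' a Ω') ∧ ∀ a x, V (π a x) = π' a (V x) := by
  have hd := h.denseRange
  have hn : ∀ a, ‖orbitMap π' Ω' a‖ = ‖orbitMap π Ω a‖ := norm_rep_apply_eq h.eq_inner h'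
  let f := (orbitMap π' Ω').extendOfNorm (orbitMap π Ω)
  have hf : ∀ a, f (π a Ω) = π' a Ω' :=
    LinearMap.extendOfNorm_eq hd ⟨1, fun a => by rw [one_mul, hn]⟩
  have hfn : ∀ x, ‖f x‖ = ‖x‖ := fun x =>
    hd.induction_on x (isClosed_eq (by fun_prop) (by fun_prop)) fun a => by
      rw [orbitMap_apply, hf, ← orbitMap_apply, hn, orbitMap_apply]
  refine ⟨⟨f.toLinearMap, hfn⟩, hf, fun a x => ?_⟩
  change f (π a x) = π' a (f x)
  refine hd.induction_on x (isClosed_eq (by fun_prop) (by fun_prop)) fun b => ?_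
  rw [orbitMap_apply, ← rep_mul_apply, hf, hf, rep_mul_apply]

theorem IsGNSTriple.exists_unitary {φ : A →ₗ[ℂ] ℂ} {π : A →⋆ₐ[ℂ] (H →L[ℂ] H)} {Ω : H}
    (h : IsGNSTriple φ π Ω) {π' : A →⋆ₐ[ℂ] (H' →L[ℂ] H')} {Ω' : H'}
    (h' : IsGNSTriple φ π' Ω') :
    ∃ V : H ≃ₗᵢ[ℂ] H', (∀ a, V (π a Ω) = π' a Ω') ∧ ∀ a x, V (π a x) = π' a (V x) := by
  obtain ⟨V, hV, hV'⟩ := h.exists_isometry h'.eq_inner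
  have hs : Function.Surjective V := surjective_of_denseRange V
    (h'.cyclic.mono (by rintro _ ⟨a, rfl⟩; exact ⟨_, hV a⟩))
  exact ⟨LinearIsometryEquiv.ofSurjective V hs, hV, hV'⟩

/-- A closed invariant subspace is reducing. -/
theorem starProjection_rep {π : A →⋆ₐ[ℂ] (H →L[ℂ] H)} {K : Submodule ℂ H}
    [K.HasOrthogonalProjection] (hK : ∀ a, ∀ x ∈ K, π a x ∈ K) (a : A) (x : H) :
    K.starProjection (π a x) = π a (K.starProjection x) := by
  refine Submodule.eq_starProjection_of_mem_of_inner_eq_zero (hK a _ (by simp)) fun w hw => ?_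
  rw [← map_sub, inner_rep_left]
  exact Submodule.starProjection_inner_eq_zero _ _ (hK _ _ hw)

theorem IsGNSTriple.norm_eq_one {φ : A →ₗ[ℂ] ℂ} (hφ : φ 1 = 1) {π : A →⋆ₐ[ℂ] (H →L[ℂ] H)}
    {Ω : H} (h : IsGNSTriple φ π Ω) : ‖Ω‖ = 1 := by
  have := h.eq_inner 1
  rw [hφ, rep_one_apply] at this
  rw [@norm_eq_sqrt_re_inner ℂ, ← this]
  simp

theorem IsGNSTriple.eq_of_inner_eq {φ : A →ₗ[ℂ] ℂ} {π : A →⋆ₐ[ℂ] (H →L[ℂ] H)}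
    {Ω : H} (h : IsGNSTriple φ π Ω) {x y : H} (hxy : ∀ a, ⟪x, π a Ω⟫_ℂ = ⟪y, π a Ω⟫_ℂ) :
    x = y :=
  ext_inner_right ℂ fun z => h.denseRange.induction_on z
    (isClosed_eq (by fun_prop) (by fun_prop)) fun a => hxy a

/-- The GNS representation of a pure state is irreducible. -/
theorem IsPureState.isIrreducibleRep {φ : A →ₗ[ℂ] ℂ} (hφ : IsPureState φ)
    {π : A →⋆ₐ[ℂ] (H →L[ℂ] H)} {Ω : H} (h : IsGNSTriple φ π Ω) : IsIrreducibleRep π := by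
  obtain ⟨hst, hext⟩ := hφ
  have hst : IsState φ := hst
  have hΩ : ‖Ω‖ = 1 := h.norm_eq_one hst.map_one
  refine ⟨⟨Ω, 0, by intro h0; simp [h0] at hΩ⟩, fun K hK hinv => ?_⟩
  have : CompleteSpace K := hK.completeSpace_coe
  set P := K.starProjection with hP
  have hcomm : ∀ a x, P (π a x) = π a (P x) := starProjection_rep hinv
  have hPP : ∀ x, P (P x) = P x := fun x =>
    Submodule.starProjection_eq_self_iff.2 (by simp [hP])
  have hPsa : ∀ x y, ⟪P x, y⟫_ℂ = ⟪x, P y⟫_ℂ := fun x y =>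
    Submodule.inner_starProjection_left_eq_right K x y
  have key : ∀ Q : H →L[ℂ] H, (∀ a x, Q (π a x) = π a (Q x)) → (∀ x, Q (Q x) = Q x) →
      (∀ x y, ⟪Q x, y⟫_ℂ = ⟪x, Q y⟫_ℂ) → ∀ a, ⟪Q Ω, π a Ω⟫_ℂ = ⟪Q Ω, π a (Q Ω)⟫_ℂ := by
    intro Q h1 h2 h3 a
    rw [← h1, ← h3, h2]
  have hstate : ∀ x : H, x ≠ 0 → IsState
      (((‖x‖ ^ 2 : ℝ) : ℂ)⁻¹ • ((innerSL ℂ x).toLinearMap ∘ₗ orbitMap π x)) := by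
    intro x hx
    constructor
    · intro a
      change 0 ≤ (((‖x‖ ^ 2 : ℝ) : ℂ)⁻¹ * ⟪x, π (star a * a) x⟫_ℂ)
      have hr : ((‖x‖ ^ 2 : ℝ) : ℂ)⁻¹ * ⟪x, π (star a * a) x⟫_ℂ
          = (((‖x‖ ^ 2)⁻¹ * ‖π a x‖ ^ 2 : ℝ) : ℂ) := by
        rw [rep_mul_apply, ← inner_rep_left, inner_self_eq_norm_sq_to_K]
        push_cast
        rfl
      rw [hr, Complex.zero_le_real]
      positivity
    · change (((‖x‖ ^ 2 : ℝ) : ℂ)⁻¹ * ⟪x, π 1 x⟫_ℂ) = 1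
      rw [rep_one_apply, inner_self_eq_norm_sq_to_K]
      have : (‖x‖ : ℂ) ≠ 0 := by simpa using hx
      push_cast
      exact inv_mul_cancel₀ (pow_ne_zero _ this)
  let R : H →L[ℂ] H := 1 - P
  have hRx : ∀ x, R x = x - P x := fun _ => rfl
  have hR1 : ∀ a x, R (π a x) = π a (R x) := fun a x => by simp [hRx, hcomm]
  have hR2 : ∀ x, R (R x) = R x := fun x => by simp [hRx, hPP]
  have hR3 : ∀ x y, ⟪R x, y⟫_ℂ = ⟪x, R y⟫_ℂ := fun x y => by
    rw [hRx, hRx, inner_sub_left, inner_sub_right, hPsa]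
  by_cases h0 : P Ω = 0
  · left
    have : ∀ x, P x = 0 := fun x => h.denseRange.induction_on x
      (isClosed_eq (by fun_prop) (by fun_prop)) fun a => by
        rw [orbitMap_apply, hcomm, h0, map_zero]
    rw [Submodule.eq_bot_iff]
    intro x hx
    rw [← this x, hP, Submodule.starProjection_eq_self_iff.2 hx]
  by_cases h1 : R Ω = 0
  · right
    have : ∀ x, R x = 0 := fun x => h.denseRange.induction_on x
      (isClosed_eq (by fun_prop) (by fun_prop)) fun a => by
        rw [orbitMap_apply, hR1, h1, map_zero]
    rw [Submodule.eq_top_iff']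
    intro x
    rw [← Submodule.starProjection_eq_self_iff, ← sub_eq_zero, ← neg_eq_zero, neg_sub]
    exact this x
  -- Now `φ` is the convex combination, with weights `‖PΩ‖²` and `‖RΩ‖²`, of the vector states of
  -- the normalized `PΩ` and `RΩ`. Extremality makes the first of these equal to `φ`, and cyclicity
  -- turns this into `PΩ = ‖PΩ‖² Ω`, which is incompatible with `RΩ ≠ 0`.
  exfalso
  have hpos0 : 0 < ‖P Ω‖ ^ 2 := by positivity
  have hpos1 : 0 < ‖R Ω‖ ^ 2 := by positivity
  have hsum : ‖P Ω‖ ^ 2 + ‖R Ω‖ ^ 2 = 1 := by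
    have e1 : ⟪Ω, P Ω⟫_ℂ + ⟪Ω, R Ω⟫_ℂ = ⟪Ω, Ω⟫_ℂ := by simp [hRx]
    rw [← hPP, ← hPsa, ← hR2, ← hR3, inner_self_eq_norm_sq_to_K, inner_self_eq_norm_sq_to_K,
      inner_self_eq_norm_sq_to_K, hΩ] at e1
    have e2 : (((‖P Ω‖ ^ 2 + ‖R Ω‖ ^ 2 : ℝ)) : ℂ) = ((1 : ℝ) : ℂ) := by
      push_cast; simpa using e1
    exact_mod_cast e2
  have hφ1 : (((‖P Ω‖ ^ 2 : ℝ) : ℂ)⁻¹ • ((innerSL ℂ (P Ω)).toLinearMap ∘ₗ orbitMap π (P Ω)))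
      = φ := by
    refine hext (hstate _ h0) (hstate _ h1) ⟨‖P Ω‖ ^ 2, ‖R Ω‖ ^ 2, hpos0, hpos1, hsum, ?_⟩
    ext a
    change ((‖P Ω‖ ^ 2 : ℝ) • (((‖P Ω‖ ^ 2 : ℝ) : ℂ)⁻¹ * ⟪P Ω, π a (P Ω)⟫_ℂ)
      + (‖R Ω‖ ^ 2 : ℝ) • (((‖R Ω‖ ^ 2 : ℝ) : ℂ)⁻¹ * ⟪R Ω, π a (R Ω)⟫_ℂ)) = φ a
    rw [Complex.real_smul, Complex.real_smul, mul_inv_cancel_left₀ (by exact_mod_cast hpos0.ne'),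
      mul_inv_cancel_left₀ (by exact_mod_cast hpos1.ne'), ← key P hcomm hPP hPsa,
      ← key R hR1 hR2 hR3, ← inner_add_left, h.eq_inner]
    simp [hRx]
  have hPΩ : P Ω = ((‖P Ω‖ ^ 2 : ℝ) : ℂ) • Ω := by
    refine h.eq_of_inner_eq fun a => ?_
    have := DFunLike.congr_fun hφ1 a
    change ((‖P Ω‖ ^ 2 : ℝ) : ℂ)⁻¹ * ⟪P Ω, π a (P Ω)⟫_ℂ = φ a at this
    rw [inner_smul_left, ← h.eq_inner, ← this, key P hcomm hPP hPsa, Complex.conj_ofReal,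
      mul_inv_cancel_left₀ (by exact_mod_cast hpos0.ne')]
  have h2 : ((‖P Ω‖ ^ 2 : ℝ) : ℂ) • R Ω = 0 := by
    have := hPP Ω
    rw [hRx, smul_sub, ← hPΩ, ← map_smul, ← hPΩ, hPP, sub_self]
  rcases smul_eq_zero.1 h2 with h2 | h2
  · exact hpos0.ne' (by exact_mod_cast h2)
  · exact h1 h2

end Representations

/-! ### Schur's lemma, and irreducible representations from type I factors -/

section Irreducible

variable {A : Type*} [Ring A] [StarRing A] [Algebra ℂ A]
  {H : Type*} [NormedAddCommGroup H] [InnerProductSpace ℂ H] [CompleteSpace H]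
  {H' : Type*} [NormedAddCommGroup H'] [InnerProductSpace ℂ H'] [CompleteSpace H']

theorem IsIrreducibleRep.eq_zero_or_injective {π : A →⋆ₐ[ℂ] (H →L[ℂ] H)}
    (h : IsIrreducibleRep π) (T : H →L[ℂ] H) (hT : ∀ a, Commute T (π a)) :
    T = 0 ∨ Function.Injective T := by
  rcases h.2 (LinearMap.ker T.toLinearMap) T.isClosed_ker (fun a x hx => by
      have hx : T x = 0 := hx
      have := DFunLike.congr_fun (hT a).eq x
      change T (π a x) = π a (T x) at this
      change T (π a x) = 0
      rw [this, hx, map_zero]) with h | h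
  · exact Or.inr (LinearMap.ker_eq_bot.1 h)
  · left
    ext x
    have : x ∈ LinearMap.ker T.toLinearMap := by rw [h]; trivial
    exact this

/-- Two distinct spectral points would give, by functional calculus, two nonzero operators in the
commutant with product zero. A nonzero operator in the commutant is injective, since its kernel is
closed and invariant, so this is impossible. -/
theorem IsIrreducibleRep.exists_eq_smul_one_of_isSelfAdjoint {π : A →⋆ₐ[ℂ] (H →L[ℂ] H)}
    (h : IsIrreducibleRep π) (T : H →L[ℂ] H) (hsa : IsSelfAdjoint T)
    (hT : ∀ a, Commute T (π a)) : ∃ c : ℂ, T = c • (1 : H →L[ℂ] H) := by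
  have := h.1
  have hne : (spectrum ℝ T).Nonempty := ContinuousFunctionalCalculus.spectrum_nonempty T hsa
  obtain ⟨r, hr⟩ := hne
  by_cases hsub : spectrum ℝ T ⊆ {r}
  · have := CFC.eq_algebraMap_of_spectrum_subset_singleton T r hsub hsa
    refine ⟨(r : ℂ), ?_⟩
    rw [this, Algebra.algebraMap_eq_smul_one, ← Complex.coe_smul]
  obtain ⟨s, hs, hsr⟩ := Set.not_subset.1 hsub
  have hsr : s ≠ r := hsr
  exfalso
  have main : ∀ s t : ℝ, s ∈ spectrum ℝ T → t ∈ spectrum ℝ T → s < t → False := by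
    intro s t hs ht hst
    let m := (s + t) / 2
    -- The parts of the line to the right and to the left of the midpoint: `f * g = 0`, while `f t`
    -- and `g s` are nonzero.
    let f : ℝ → ℝ := fun x => max 0 (x - m)
    let g : ℝ → ℝ := fun x => max 0 (m - x)
    have hf : Continuous f := by fun_prop
    have hg : Continuous g := by fun_prop
    have hfg : cfc f T * cfc g T = 0 := by
      rw [← cfc_mul f g T (by fun_prop) (by fun_prop)]
      have : (fun x => f x * g x) = fun _ => 0 := by
        funext x
        rcases le_total x m with hx | hx
        · simp [f, hx]
        · simp [g, hx]
      rw [this, cfc_const_zero]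
    have hne : ∀ (f : ℝ → ℝ) (_ : Continuous f) (t : ℝ), t ∈ spectrum ℝ T → f t ≠ 0 →
        cfc f T ≠ 0 := by
      intro f hf t ht hft h0
      have h1 : f t ∈ spectrum ℝ (cfc f T) := by
        rw [cfc_map_spectrum f T hsa hf.continuousOn]
        exact ⟨t, ht, rfl⟩
      rw [h0, spectrum.zero_eq] at h1
      exact hft h1
    rcases h.eq_zero_or_injective (cfc f T) (fun a => (hT a).cfc_real f) with h0 | h0
    · exact hne f hf t ht (by simp only [f, m]; rw [max_eq_right] <;> linarith) h0
    · refine hne g hg s hs (by simp only [g, m]; rw [max_eq_right] <;> linarith) ?_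
      ext x
      apply h0
      rw [zero_apply, map_zero]
      exact DFunLike.congr_fun hfg x
  rcases lt_or_gt_of_ne hsr with h | h
  · exact main s r hs hr h
  · exact main r s hr hs h

/-- Schur's lemma: the commutant of an irreducible representation consists of the scalars. -/
theorem IsIrreducibleRep.exists_eq_smul_one {π : A →⋆ₐ[ℂ] (H →L[ℂ] H)}
    (h : IsIrreducibleRep π) (T : H →L[ℂ] H)
    (hT : ∀ a, Commute T (π a)) : ∃ c : ℂ, T = c • (1 : H →L[ℂ] H) := by
  have hT' : ∀ a, Commute (star T) (π a) := fun a => by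
    have := (hT (star a)).star_star
    rwa [← map_star, star_star] at this
  obtain ⟨c, hc⟩ := h.exists_eq_smul_one_of_isSelfAdjoint (T + star T)
    (by simp [IsSelfAdjoint, add_comm]) (fun a => (hT a).add_left (hT' a))
  obtain ⟨e, he⟩ := h.exists_eq_smul_one_of_isSelfAdjoint (Complex.I • (T - star T))
    (by simp [IsSelfAdjoint, star_smul, ← smul_neg]) (fun a => ((hT a).sub_left (hT' a)).smul_left _)
  -- From `T + T* = c` and `i (T - T*) = e` it follows that `2T = c - ie`.
  refine ⟨(c - Complex.I * e) / 2, ?_⟩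
  have h2 : (2 : ℂ) • T = (c - Complex.I * e) • (1 : H →L[ℂ] H) := by
    rw [sub_smul, mul_smul, ← hc, ← he, smul_smul, Complex.I_mul_I, two_smul, neg_smul, one_smul]
    abel
  rw [div_eq_inv_mul, mul_smul, ← h2, smul_smul]
  simp

/-- A nonzero operator intertwining an irreducible representation with another one is a multiple of
an isometry. -/
theorem IsIrreducibleRep.exists_isometry_of_intertwiner {π : A →⋆ₐ[ℂ] (H →L[ℂ] H)}
    (h : IsIrreducibleRep π) {π' : A →⋆ₐ[ℂ] (H' →L[ℂ] H')} (T : H →L[ℂ] H')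
    (hT : ∀ a x, T (π a x) = π' a (T x)) (h0 : T ≠ 0) :
    ∃ (c : ℂ) (V : H →ₗᵢ[ℂ] H'), (∀ x, V x = c • T x) ∧ ∀ a x, V (π a x) = π' a (V x) := by
  have hTa : ∀ a y, T.adjoint (π' a y) = π a (T.adjoint y) := by
    intro a y
    refine ext_inner_left ℂ fun x => ?_
    rw [ContinuousLinearMap.adjoint_inner_right, ← inner_star_rep, ← hT, ← inner_star_rep,
      ContinuousLinearMap.adjoint_inner_right]
  obtain ⟨c, hc⟩ := h.exists_eq_smul_one (T.adjoint ∘L T) (fun a => by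
    ext x
    change T.adjoint (T (π a x)) = π a (T.adjoint (T x))
    rw [hT, hTa])
  -- `T* T` lies in the commutant, so it is a scalar; dividing `T` by its square root gives the
  -- isometry.
  have hn : ∀ x, ‖T x‖ ^ 2 = c.re * ‖x‖ ^ 2 := by
    intro x
    have h1 : ⟪T x, T x⟫_ℂ = c * ⟪x, x⟫_ℂ := by
      rw [← ContinuousLinearMap.adjoint_inner_right, ← inner_smul_right]
      congr 1
      exact DFunLike.congr_fun hc x
    rw [inner_self_eq_norm_sq_to_K, inner_self_eq_norm_sq_to_K] at h1
    have := congrArg Complex.re h1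
    rw [← RCLike.ofReal_pow, ← RCLike.ofReal_pow] at this
    change ((‖T x‖ ^ 2 : ℝ) : ℂ).re = (c * ((‖x‖ ^ 2 : ℝ) : ℂ)).re at this
    rwa [Complex.re_mul_ofReal, Complex.ofReal_re] at this
  have hcpos : 0 < c.re := by
    obtain ⟨x, hx⟩ : ∃ x, T x ≠ 0 := by
      by_contra! hx
      exact h0 (ContinuousLinearMap.ext hx)
    have h1 : 0 < ‖T x‖ ^ 2 := by positivity
    rw [hn] at h1
    exact pos_of_mul_pos_left h1 (by positivity)
  have hs : 0 < Real.sqrt c.re := Real.sqrt_pos.2 hcpos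
  refine ⟨((Real.sqrt c.re)⁻¹ : ℝ), ⟨((((Real.sqrt c.re)⁻¹ : ℝ) : ℂ) • T).toLinearMap,
    fun x => ?_⟩, fun x => rfl, fun a x => ?_⟩
  · change ‖(((Real.sqrt c.re)⁻¹ : ℝ) : ℂ) • T x‖ = ‖x‖
    have : ‖T x‖ = Real.sqrt c.re * ‖x‖ := by
      rw [← Real.sqrt_sq (norm_nonneg (T x)), hn, Real.sqrt_mul hcpos.le,
        Real.sqrt_sq (norm_nonneg x)]
    rw [norm_smul, this, Complex.norm_real, Real.norm_of_nonneg (by positivity),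
      inv_mul_cancel_left₀ hs.ne']
  · change (((Real.sqrt c.re)⁻¹ : ℝ) : ℂ) • T (π a x) = π' a ((((Real.sqrt c.re)⁻¹ : ℝ) : ℂ) • T x)
    rw [hT, map_smul]

/-- An isometry whose range is invariant under an irreducible family of operators is onto. -/
theorem IsIrreducibleRep.surjective_of_range_invariant {G : Type*} [NormedAddCommGroup G]
    [InnerProductSpace ℂ G] [CompleteSpace G] [Nontrivial G] {π : A →⋆ₐ[ℂ] (H →L[ℂ] H)}
    (h : IsIrreducibleRep π) (V : G →ₗᵢ[ℂ] H)
    (hV : ∀ a x, ∃ y, V y = π a (V x)) : Function.Surjective V := by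
  rcases h.2 (LinearMap.range V.toLinearMap) (by
      exact V.isometry.isClosedEmbedding.isClosed_range) (by
      rintro a _ ⟨x, rfl⟩
      exact hV a x) with h0 | h0
  · exfalso
    obtain ⟨x, hx⟩ := exists_ne (0 : G)
    have : V x ∈ LinearMap.range V.toLinearMap := ⟨x, rfl⟩
    rw [h0, Submodule.mem_bot] at this
    exact hx (V.injective (by rw [this, map_zero]))
  · exact LinearMap.range_eq_top.1 h0

/-- If `π(A)″` is a type I factor, then `π` contains an irreducible representation. -/
theorem exists_irreducible_of_isTypeIFactor {H : Type u} [NormedAddCommGroup H]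
    [InnerProductSpace ℂ H] [CompleteSpace H] {σ : A →⋆ₐ[ℂ] (H →L[ℂ] H)}
    (h : IsTypeIFactor (bicommutant σ)) :
    ∃ (K : Type u) (_ : NormedAddCommGroup K) (_ : InnerProductSpace ℂ K) (_ : CompleteSpace K)
      (π : A →⋆ₐ[ℂ] (K →L[ℂ] K)) (V : K →ₗᵢ[ℂ] H),
      IsIrreducibleRep π ∧ ∀ a x, V (π a x) = σ a (V x) := by
  obtain ⟨K, _, _, _, hK, ⟨θ⟩⟩ := h
  let M := (bicommutant σ).toStarSubalgebra
  have hmem : ∀ a, σ a ∈ M := fun a => by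
    change σ a ∈ StarSubalgebra.centralizer ℂ _
    rw [StarSubalgebra.mem_centralizer_iff]
    intro g hg
    have hg1 := (StarSubalgebra.mem_centralizer_iff ℂ).1 hg _ ⟨a, rfl⟩
    have hg2 := (StarSubalgebra.mem_centralizer_iff ℂ).1 (star_mem hg) _ ⟨a, rfl⟩
    exact ⟨hg1.1.symm, hg2.1.symm⟩
  have hcomm : ∀ T : H →L[ℂ] H, (∀ a, T * σ a = σ a * T) → ∀ m ∈ M, T * m = m * T := by
    intro T hT m hm
    refine ((StarSubalgebra.mem_centralizer_iff ℂ).1 hm T ?_).1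
    refine (StarSubalgebra.mem_centralizer_iff ℂ).2 ?_
    rintro _ ⟨a, rfl⟩
    refine ⟨(hT a).symm, ?_⟩
    rw [← map_star]
    exact (hT _).symm
  obtain ⟨k, hk⟩ : ∃ k : K, ‖k‖ = 1 := exists_norm_eq K zero_le_one
  -- Matrix units pulled back to `M`: `r y` corresponds to `|y⟩⟨k|`, and `r k` is a minimal
  -- projection. With a unit vector `ξ` in the range of `r k`, the map `y ↦ r y ξ` embeds `K`
  -- isometrically in `H` and intertwines `θ m` with `m`.
  let r : K → M := fun y => θ.symm (InnerProductSpace.rankOne ℂ y k)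
  have hr0 : r k ≠ 0 := by
    intro h0
    have : InnerProductSpace.rankOne ℂ k k = 0 := by
      rw [← θ.apply_symm_apply (InnerProductSpace.rankOne ℂ k k)]
      change θ (r k) = 0
      rw [h0, map_zero]
    have hk0 : k ≠ 0 := by intro h0; simp [h0] at hk
    exact InnerProductSpace.rankOne_ne_zero hk0 hk0 this
  have hrr : r k * r k = r k := by
    rw [← map_mul]
    congr 1
    ext x
    simp [hk]
  obtain ⟨ξ, hξ1, hξ⟩ : ∃ ξ : H, ‖ξ‖ = 1 ∧ (r k : H →L[ℂ] H) ξ = ξ := by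
    obtain ⟨x, hx⟩ : ∃ x, (r k : H →L[ℂ] H) x ≠ 0 := by
      by_contra! hx
      exact hr0 (Subtype.ext (ContinuousLinearMap.ext hx))
    refine ⟨((‖(r k : H →L[ℂ] H) x‖⁻¹ : ℝ) : ℂ) • (r k : H →L[ℂ] H) x, ?_, ?_⟩
    · rw [norm_smul, Complex.norm_real, norm_inv, norm_norm, inv_mul_cancel₀ (norm_ne_zero_iff.2 hx)]
    · rw [map_smul]
      congr 1
      exact DFunLike.congr_fun (congrArg Subtype.val hrr) x
  -- products `r(y)* r(z)` are multiples of the minimal projection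
  have hrs : ∀ y z, star (r y) * r z = ⟪y, z⟫_ℂ • r k := by
    intro y z
    change star (θ.symm _) * _ = _
    rw [← map_star, ← map_mul, ← map_smul]
    congr 1
    ext x
    rw [ContinuousLinearMap.star_eq_adjoint, InnerProductSpace.adjoint_rankOne]
    simp [smul_smul, mul_comm]
  let V₀ : K →ₗ[ℂ] H :=
    { toFun := fun y => (r y : H →L[ℂ] H) ξ
      map_add' := fun y z => by simp [r]
      map_smul' := fun c y => by simp [r] }
  have hV₀ : ∀ y, ‖V₀ y‖ = ‖y‖ := by
    intro y
    rw [@norm_eq_sqrt_re_inner ℂ, @norm_eq_sqrt_re_inner ℂ _ _ _ _ y]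
    congr 2
    change ⟪(r y : H →L[ℂ] H) ξ, (r y : H →L[ℂ] H) ξ⟫_ℂ = _
    rw [← ContinuousLinearMap.adjoint_inner_right, ← ContinuousLinearMap.star_eq_adjoint]
    have h1 : star (r y : H →L[ℂ] H) ((r y : H →L[ℂ] H) ξ) = ⟪y, y⟫_ℂ • ξ := by
      conv_rhs => rw [← hξ]
      exact DFunLike.congr_fun (congrArg Subtype.val (hrs y y)) ξ
    rw [h1, inner_smul_right, inner_self_eq_norm_sq_to_K, inner_self_eq_norm_sq_to_K, hξ1]
    simp
  let V : K →ₗᵢ[ℂ] H := ⟨V₀, hV₀⟩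
  have hVm : ∀ (m : M) y, V (θ m y) = (m : H →L[ℂ] H) (V y) := by
    intro m y
    have h1 : r (θ m y) = m * r y := by
      apply θ.injective
      have h2 : ∀ z, θ (r z) = InnerProductSpace.rankOne ℂ z k := fun z =>
        θ.apply_symm_apply _
      have h3 : θ (m * r y) = θ m * θ (r y) := map_mul θ _ _
      change θ (r (θ m y)) = θ (m * r y)
      rw [h3, h2, h2]
      ext x
      change ⟪k, x⟫_ℂ • θ m y = θ m (⟪k, x⟫_ℂ • y)
      rw [map_smul]
    change (r (θ m y) : H →L[ℂ] H) ξ = _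
    rw [h1]
    rfl
  let π : A →⋆ₐ[ℂ] (K →L[ℂ] K) := θ.toStarAlgHom.comp (σ.codRestrict M hmem)
  have hπ : ∀ a x, V (π a x) = σ a (V x) := fun a x => hVm ⟨σ a, hmem a⟩ x
  refine ⟨K, _, _, _, π, V, ⟨hK, fun L hL hinv => ?_⟩, hπ⟩
  have : CompleteSpace L := hL.completeSpace_coe
  set P := L.starProjection with hP
  have hPc : ∀ a x, P (π a x) = π a (P x) := starProjection_rep hinv
  let V' := V.toContinuousLinearMap
  have hVa : ∀ (m : M) y, V'.adjoint ((m : H →L[ℂ] H) y) = θ m (V'.adjoint y) := by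
    intro m y
    refine ext_inner_left ℂ fun x => ?_
    have h1 : ∀ z, ⟪x, θ m z⟫_ℂ = ⟪θ (star m) x, z⟫_ℂ := fun z => by
      rw [map_star, ContinuousLinearMap.star_eq_adjoint, ContinuousLinearMap.adjoint_inner_left]
    have h2 : ∀ (x z : H), ⟪x, (m : H →L[ℂ] H) z⟫_ℂ = ⟪((star m : M) : H →L[ℂ] H) x, z⟫_ℂ := by
      intro x z
      change _ = ⟪(star (m : H →L[ℂ] H)) x, z⟫_ℂ
      rw [ContinuousLinearMap.star_eq_adjoint, ContinuousLinearMap.adjoint_inner_left]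
    rw [ContinuousLinearMap.adjoint_inner_right, h1, ContinuousLinearMap.adjoint_inner_right, h2]
    congr 1
    exact (hVm _ _).symm
  have hVV : ∀ x, V'.adjoint (V x) = x := fun x => by
    refine ext_inner_left ℂ fun z => ?_
    rw [ContinuousLinearMap.adjoint_inner_right]
    exact V.inner_map_map z x
  -- `V P V*` commutes with `σ(A)`, hence with all of the bicommutant `M`. Compressing by `V` shows
  -- that `P` commutes with every `θ m`, that is, with all of `B(K)`. No continuity of `θ` is
  -- needed.
  have hPM : ∀ (m : M) x, P (θ m x) = θ m (P x) := by
    intro m x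
    have h1 := hcomm (V' ∘L P ∘L V'.adjoint) (fun a => by
      ext y
      change V (P (V'.adjoint (σ a y))) = σ a (V (P (V'.adjoint y)))
      rw [← hπ, ← hPc]
      congr 2
      exact hVa ⟨σ a, hmem a⟩ y) m m.2
    have h2 := congrArg V'.adjoint (DFunLike.congr_fun h1 (V x))
    change V'.adjoint (V (P (V'.adjoint ((m : H →L[ℂ] H) (V x)))))
      = V'.adjoint ((m : H →L[ℂ] H) (V (P (V'.adjoint (V x))))) at h2
    rwa [hVV, hVa, hVa, hVV, hVV] at h2
  by_cases hbot : L = ⊥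
  · exact Or.inl hbot
  right
  obtain ⟨x, hxL, hx⟩ := (Submodule.ne_bot_iff _).1 hbot
  rw [Submodule.eq_top_iff']
  intro y
  -- The operator `|y⟩⟨x|` sends `x ∈ L` to a nonzero multiple of the arbitrary vector `y`.
  have h1 := hPM (θ.symm (InnerProductSpace.rankOne ℂ y x)) x
  rw [θ.apply_symm_apply, hP, Submodule.starProjection_eq_self_iff.2 hxL, ← hP,
    InnerProductSpace.rankOne_apply, map_smul] at h1
  have h2 : P y = y := smul_right_injective K (inner_self_ne_zero.2 hx) h1
  exact Submodule.starProjection_eq_self_iff.1 h2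

end Irreducible
/-! ### The Hilbert space tensor product -/

section HilbertTensor

variable {H : Type*} [NormedAddCommGroup H] [InnerProductSpace ℂ H]
  {K : Type*} [NormedAddCommGroup K] [InnerProductSpace ℂ K]
  {H' : Type*} [NormedAddCommGroup H'] [InnerProductSpace ℂ H']
  {K' : Type*} [NormedAddCommGroup K'] [InnerProductSpace ℂ K']
  {E : Type*} [NormedAddCommGroup E] [InnerProductSpace ℂ E]

/-- The simple tensor as a continuous bilinear map. -/
noncomputable def hTmulL (ξ : H) : K →L[ℂ] HilbertTensor H K :=
  UniformSpace.Completion.toComplL ∘L TensorProduct.mkL ℂ H K ξ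

theorem hTmul_add_left (ξ ξ' : H) (η : K) : hTmul (ξ + ξ') η = hTmul ξ η + hTmul ξ' η := by
  unfold hTmul
  rw [TensorProduct.add_tmul, UniformSpace.Completion.coe_add]

theorem hTmul_smul_left (c : ℂ) (ξ : H) (η : K) : hTmul (c • ξ) η = c • hTmul ξ η := by
  unfold hTmul
  rw [← TensorProduct.smul_tmul', UniformSpace.Completion.coe_smul]

theorem hTmul_add_right (ξ : H) (η η' : K) : hTmul ξ (η + η') = hTmul ξ η + hTmul ξ η' :=
  map_add (hTmulL ξ) η η'

theorem hTmul_smul_right (c : ℂ) (ξ : H) (η : K) : hTmul ξ (c • η) = c • hTmul ξ η :=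
  map_smul (hTmulL ξ) c η

theorem inner_hTmul (ξ ξ' : H) (η η' : K) :
    ⟪hTmul ξ η, hTmul ξ' η'⟫_ℂ = ⟪ξ, ξ'⟫_ℂ * ⟪η, η'⟫_ℂ := by
  unfold hTmul
  rw [UniformSpace.Completion.inner_coe, TensorProduct.inner_tmul]

theorem hilbertTensor_induction {p : HilbertTensor H K → Prop} (hp : IsClosed {t | p t})
    (tmul : ∀ ξ η, p (hTmul ξ η)) (add : ∀ s t, p s → p t → p (s + t)) (t : HilbertTensor H K) :
    p t := by
  induction t using UniformSpace.Completion.induction_on with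
  | hp => exact hp
  | ih a =>
    induction a using TensorProduct.induction_on with
    | zero =>
      have := tmul 0 0
      unfold hTmul at this
      rwa [TensorProduct.zero_tmul] at this
    | tmul x y => exact tmul x y
    | add x y hx hy =>
      rw [UniformSpace.Completion.coe_add]
      exact add _ _ hx hy

/-- The universal property of the Hilbert space tensor product for isometries. -/
theorem exists_isometry_hilbertTensor [CompleteSpace E] (f : H →ₗ[ℂ] K →ₗ[ℂ] E)
    (hf : ∀ ξ ξ' η η', ⟪f ξ η, f ξ' η'⟫_ℂ = ⟪ξ, ξ'⟫_ℂ * ⟪η, η'⟫_ℂ) :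
    ∃ J : HilbertTensor H K →ₗᵢ[ℂ] E, ∀ ξ η, J (hTmul ξ η) = f ξ η := by
  let g := TensorProduct.lift f
  have hg : ∀ s t, ⟪g s, g t⟫_ℂ = ⟪s, t⟫_ℂ := by
    intro s t
    induction s using TensorProduct.induction_on with
    | zero => simp
    | add x y hx hy => rw [map_add, inner_add_left, inner_add_left, hx, hy]
    | tmul x y =>
      induction t using TensorProduct.induction_on with
      | zero => simp
      | add x y hx hy => rw [map_add, inner_add_right, inner_add_right, hx, hy]
      | tmul x' y' => simp [g, hf]
  have hgn : ∀ s, ‖g s‖ = ‖s‖ := fun s => by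
    rw [@norm_eq_sqrt_re_inner ℂ, @norm_eq_sqrt_re_inner ℂ _ _ _ _ s, hg]
  let e : H ⊗[ℂ] K →ₗ[ℂ] HilbertTensor H K :=
    (UniformSpace.Completion.toComplL : H ⊗[ℂ] K →L[ℂ] HilbertTensor H K).toLinearMap
  have hd : DenseRange e := UniformSpace.Completion.denseRange_coe
  have hen : ∀ s, ‖e s‖ = ‖s‖ := fun s => UniformSpace.Completion.norm_coe s
  let F := g.extendOfNorm e
  have hF : ∀ s, F (e s) = g s :=
    LinearMap.extendOfNorm_eq hd ⟨1, fun s => by rw [one_mul, hgn, hen]⟩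
  have hFn : ∀ x, ‖F x‖ = ‖x‖ := fun x =>
    hd.induction_on x (isClosed_eq (by fun_prop) (by fun_prop)) fun s => by rw [hF, hgn, hen]
  refine ⟨⟨F.toLinearMap, hFn⟩, fun ξ η => ?_⟩
  exact (hF (ξ ⊗ₜ η)).trans (TensorProduct.lift.tmul ξ η)

theorem surjective_of_hTmul_mem_range [CompleteSpace E] (J : E →ₗᵢ[ℂ] HilbertTensor H K)
    (hJ : ∀ ξ η, ∃ x, J x = hTmul ξ η) : Function.Surjective J := by
  refine hilbertTensor_induction (p := fun t => ∃ s, J s = t) ?_ hJ ?_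
  · exact J.isometry.isClosedEmbedding.isClosed_range
  · rintro _ _ ⟨s, rfl⟩ ⟨t, rfl⟩
    exact ⟨s + t, map_add _ _ _⟩

/-- The flip `ξ ⊗ η ↦ η ⊗ ξ`. -/
theorem exists_flip (H K : Type*) [NormedAddCommGroup H] [InnerProductSpace ℂ H]
    [NormedAddCommGroup K] [InnerProductSpace ℂ K] :
    ∃ F : HilbertTensor H K ≃ₗᵢ[ℂ] HilbertTensor K H, ∀ ξ η, F (hTmul ξ η) = hTmul η ξ := by
  obtain ⟨J, hJ⟩ := exists_isometry_hilbertTensor (E := HilbertTensor K H) (LinearMap.mk₂ ℂ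
    (fun (ξ : H) (η : K) => hTmul η ξ) (fun ξ ξ' η => hTmul_add_right η ξ ξ')
    (fun c ξ η => hTmul_smul_right c η ξ) (fun ξ η η' => hTmul_add_left η η' ξ)
    (fun c ξ η => hTmul_smul_left c η ξ)) (fun ξ ξ' η η' => by
      rw [LinearMap.mk₂_apply, LinearMap.mk₂_apply, inner_hTmul, mul_comm])
  exact ⟨LinearIsometryEquiv.ofSurjective J
    (surjective_of_hTmul_mem_range J fun ξ η => ⟨hTmul η ξ, hJ η ξ⟩), hJ⟩

/-- The tensor product of two unitaries. -/
theorem exists_tensorMap (u : H ≃ₗᵢ[ℂ] H') (w : K ≃ₗᵢ[ℂ] K') :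
    ∃ U : HilbertTensor H K ≃ₗᵢ[ℂ] HilbertTensor H' K',
      ∀ ξ η, U (hTmul ξ η) = hTmul (u ξ) (w η) := by
  obtain ⟨J, hJ⟩ := exists_isometry_hilbertTensor (E := HilbertTensor H' K') (LinearMap.mk₂ ℂ
    (fun (ξ : H) (η : K) => hTmul (u ξ) (w η))
    (fun ξ ξ' η => by rw [map_add, hTmul_add_left])
    (fun c ξ η => by rw [map_smul, hTmul_smul_left])
    (fun ξ η η' => by rw [map_add, hTmul_add_right])
    (fun c ξ η => by rw [map_smul, hTmul_smul_right]))
    (fun ξ ξ' η η' => by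
      rw [LinearMap.mk₂_apply, LinearMap.mk₂_apply, inner_hTmul, u.inner_map_map, w.inner_map_map])
  exact ⟨LinearIsometryEquiv.ofSurjective J (surjective_of_hTmul_mem_range J fun ξ η =>
    ⟨hTmul (u.symm ξ) (w.symm η), by simp [hJ]⟩), hJ⟩

end HilbertTensor

/-! ### Factorization of a space carrying two commuting representations -/

section Splitting

variable {B : Type*} [Ring B] [StarRing B] [Algebra ℂ B]
  {C : Type*} [Ring C] [StarRing C] [Algebra ℂ C]
  {H : Type*} [NormedAddCommGroup H] [InnerProductSpace ℂ H] [CompleteSpace H]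
  {K : Type*} [NormedAddCommGroup K] [InnerProductSpace ℂ K] [CompleteSpace K]
  {K' : Type*} [NormedAddCommGroup K'] [InnerProductSpace ℂ K'] [CompleteSpace K']

/-- The space of intertwiners between two representations. -/
def intertwiners (π : C →⋆ₐ[ℂ] (K →L[ℂ] K)) (σ : C →⋆ₐ[ℂ] (H →L[ℂ] H)) :
    Submodule ℂ (K →L[ℂ] H) where
  carrier := {T | ∀ c x, T (π c x) = σ c (T x)}
  add_mem' {S T} hS hT c x := by
    change S (π c x) + T (π c x) = σ c (S x + T x)
    rw [hS, hT, map_add]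
  zero_mem' c x := by
    change (0 : H) = σ c 0
    rw [map_zero]
  smul_mem' a T hT c x := by
    change a • T (π c x) = σ c (a • T x)
    rw [hT, map_smul]

theorem mem_intertwiners {π : C →⋆ₐ[ℂ] (K →L[ℂ] K)} {σ : C →⋆ₐ[ℂ] (H →L[ℂ] H)} {T : K →L[ℂ] H} :
    T ∈ intertwiners π σ ↔ ∀ c x, T (π c x) = σ c (T x) := Iff.rfl

theorem isClosed_intertwiners (π : C →⋆ₐ[ℂ] (K →L[ℂ] K)) (σ : C →⋆ₐ[ℂ] (H →L[ℂ] H)) :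
    IsClosed (intertwiners π σ : Set (K →L[ℂ] H)) := by
  have : (intertwiners π σ : Set (K →L[ℂ] H)) = ⋂ c, ⋂ x, {T | T (π c x) = σ c (T x)} := by
    ext T
    simp [mem_intertwiners]
  rw [this]
  exact isClosed_iInter fun c => isClosed_iInter fun x => isClosed_eq (by fun_prop) (by fun_prop)

/-- `S* T` commutes with `π`, so it is a scalar, whose value is read off at the unit vector `k`.
Thus the intertwiners form a Hilbert space under `⟪S k, T k⟫`, the multiplicity space of `π` in `σ`.
-/
theorem inner_intertwiners {π : C →⋆ₐ[ℂ] (K →L[ℂ] K)} (hπ : IsIrreducibleRep π)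
    {σ : C →⋆ₐ[ℂ] (H →L[ℂ] H)} {S T : K →L[ℂ] H} (hS : S ∈ intertwiners π σ)
    (hT : T ∈ intertwiners π σ) {k : K} (hk : ‖k‖ = 1) (η η' : K) :
    ⟪S η, T η'⟫_ℂ = ⟪S k, T k⟫_ℂ * ⟪η, η'⟫_ℂ := by
  obtain ⟨c, hc⟩ := hπ.exists_eq_smul_one (S.adjoint ∘L T) (fun a => by
    ext x
    change S.adjoint (T (π a x)) = π a (S.adjoint (T x))
    refine ext_inner_left ℂ fun y => ?_
    rw [hT, ContinuousLinearMap.adjoint_inner_right, ← inner_star_rep, ← hS, ← inner_star_rep,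
      ContinuousLinearMap.adjoint_inner_right])
  have h : ∀ η η', ⟪S η, T η'⟫_ℂ = c * ⟪η, η'⟫_ℂ := fun η η' => by
    rw [← ContinuousLinearMap.adjoint_inner_right, ← inner_smul_right]
    exact congrArg _ (DFunLike.congr_fun hc η')
  rw [h, h k k, inner_self_eq_norm_sq_to_K, hk]
  simp

/-- If two commuting representations `ρ` and `σ` on `H` are jointly irreducible and contain the
irreducible representations `π'` and `π`, then `H` is the tensor product of these. -/
theorem exists_tensor_unitary {ρ : B →⋆ₐ[ℂ] (H →L[ℂ] H)} {σ : C →⋆ₐ[ℂ] (H →L[ℂ] H)}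
    (hcomm : ∀ b c x, ρ b (σ c x) = σ c (ρ b x))
    (hirr : ∀ L : Submodule ℂ H, IsClosed (L : Set H) → (∀ b, ∀ x ∈ L, ρ b x ∈ L) →
      (∀ c, ∀ x ∈ L, σ c x ∈ L) → L = ⊥ ∨ L = ⊤)
    {π : C →⋆ₐ[ℂ] (K →L[ℂ] K)} (hπ : IsIrreducibleRep π) (V : K →ₗᵢ[ℂ] H)
    (hV : ∀ c x, V (π c x) = σ c (V x))
    {π' : B →⋆ₐ[ℂ] (K' →L[ℂ] K')} (hπ' : IsIrreducibleRep π') (Y : K' →ₗᵢ[ℂ] H)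
    (hY : ∀ b x, Y (π' b x) = ρ b (Y x)) :
    ∃ J : HilbertTensor K' K ≃ₗᵢ[ℂ] H, ∀ b c ξ η,
      J (hTmul (π' b ξ) (π c η)) = ρ b (σ c (J (hTmul ξ η))) := by
  have := hπ.1
  have := hπ'.1
  let N := intertwiners π σ
  have hρN : ∀ b, ∀ T ∈ N, ρ b ∘L T ∈ N := fun b T hT c x => by
    change ρ b (T (π c x)) = σ c (ρ b (T x))
    rw [hT, hcomm]
  have hVN : V.toContinuousLinearMap ∈ N := hV
  -- the ranges of the intertwiners span a dense subspace
  let D : Submodule ℂ H := Submodule.span ℂ {x | ∃ T ∈ N, ∃ η, T η = x}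
  have hD : D.topologicalClosure = ⊤ := by
    have hinv : ∀ S : H →L[ℂ] H, (∀ T ∈ N, ∀ η, S (T η) ∈ D) →
        ∀ x ∈ D.topologicalClosure, S x ∈ D.topologicalClosure := by
      intro S hS x hx
      have h1 : D ≤ D.comap S.toLinearMap := Submodule.span_le.2 (by
        rintro _ ⟨T, hT, η, rfl⟩
        exact hS T hT η)
      exact map_mem_closure S.continuous hx fun y hy => h1 hy
    rcases hirr D.topologicalClosure D.isClosed_topologicalClosure
      (fun b => hinv _ fun T hT η => Submodule.subset_span ⟨_, hρN b T hT, η, rfl⟩)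
      (fun c => hinv _ fun T hT η => Submodule.subset_span ⟨T, hT, π c η, hT c η⟩) with h | h
    · exfalso
      obtain ⟨x, hx⟩ := exists_ne (0 : K)
      have h1 : V x ∈ D.topologicalClosure :=
        D.le_topologicalClosure (Submodule.subset_span ⟨_, hVN, x, rfl⟩)
      rw [h, Submodule.mem_bot] at h1
      exact hx (V.injective (by rw [h1, map_zero]))
    · exact h
  -- If all ranges of intertwiners were orthogonal to the range of `Y`, their density would force `Y
  -- = 0`.
  obtain ⟨k, hk, T₀, hT₀, ξ₀, hne⟩ : ∃ k : K, ‖k‖ = 1 ∧ ∃ T ∈ N, ∃ ξ : K', ⟪T k, Y ξ⟫_ℂ ≠ 0 := by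
    by_contra! hall
    obtain ⟨ξ, hξ⟩ := exists_ne (0 : K')
    have h1 : ∀ x ∈ D, ⟪x, Y ξ⟫_ℂ = 0 := by
      intro x hx
      induction hx using Submodule.span_induction with
      | zero => simp
      | add x y _ _ hx hy => rw [inner_add_left, hx, hy, add_zero]
      | smul c x _ hx => rw [inner_smul_left, hx, mul_zero]
      | mem x hx =>
        obtain ⟨T, hT, η, rfl⟩ := hx
        by_cases h0 : η = 0
        · simp [h0]
        have h2 := hall (((‖η‖⁻¹ : ℝ) : ℂ) • η) (by
          rw [norm_smul, Complex.norm_real, norm_inv, norm_norm,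
            inv_mul_cancel₀ (norm_ne_zero_iff.2 h0)]) T hT ξ
        rw [map_smul, inner_smul_left] at h2
        refine (mul_eq_zero.1 h2).resolve_left ?_
        simpa using h0
    have h2 : ∀ x, ⟪x, Y ξ⟫_ℂ = 0 := by
      intro x
      have hx : x ∈ D.topologicalClosure := by rw [hD]; trivial
      have hc : IsClosed {x | ⟪x, Y ξ⟫_ℂ = 0} := isClosed_eq (by fun_prop) (by fun_prop)
      exact closure_minimal h1 hc hx
    have h3 : Y ξ = 0 := inner_self_eq_zero.1 (h2 _)
    exact hξ (Y.injective (by rw [h3, map_zero]))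
  -- evaluation at `k` is isometric on intertwiners
  have hnorm : ∀ T ∈ N, ‖T k‖ = ‖T‖ := by
    intro T hT
    refine le_antisymm ((T.le_opNorm k).trans (by rw [hk, mul_one])) ?_
    refine T.opNorm_le_bound (norm_nonneg _) fun η => le_of_eq ?_
    have h1 := inner_intertwiners hπ hT hT hk η η
    simp only [inner_self_eq_norm_sq_to_K] at h1
    have h2 : ‖T η‖ ^ 2 = ‖T k‖ ^ 2 * ‖η‖ ^ 2 := by
      have h1' : ((‖T η‖ ^ 2 : ℝ) : ℂ) = ((‖T k‖ ^ 2 * ‖η‖ ^ 2 : ℝ) : ℂ) := by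
        push_cast; exact h1
      exact_mod_cast h1'
    rw [← mul_pow] at h2
    exact (pow_left_inj₀ (norm_nonneg _) (by positivity) two_ne_zero).1 h2
  let ev : N →ₗᵢ[ℂ] H :=
    { toFun := fun T => (T : K →L[ℂ] H) k
      map_add' := fun _ _ => rfl
      map_smul' := fun _ _ => rfl
      norm_map' := fun T => hnorm T T.2 }
  have hNc : CompleteSpace N := (isClosed_intertwiners π σ).completeSpace_coe
  -- `R = {T k | T ∈ N}` is a copy of the multiplicity space inside `H`, closed and invariant under
  -- `ρ`. Projecting `Y` onto it gives a nonzero intertwiner, so `π'` embeds into the action of `ρ`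
  -- on `R`.
  let R : Submodule ℂ H := LinearMap.range ev.toLinearMap
  have hRc : IsClosed (R : Set H) := ev.isometry.isClosedEmbedding.isClosed_range
  have : CompleteSpace R := hRc.completeSpace_coe
  have hRinv : ∀ b, ∀ x ∈ R, ρ b x ∈ R := by
    rintro b _ ⟨T, rfl⟩
    exact ⟨⟨_, hρN b T T.2⟩, rfl⟩
  let Z : K' →L[ℂ] H := R.starProjection ∘L Y.toContinuousLinearMap
  have hZ : ∀ b x, Z (π' b x) = ρ b (Z x) := by
    intro b x
    change R.starProjection (Y (π' b x)) = ρ b (R.starProjection (Y x))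
    rw [hY, starProjection_rep hRinv]
  have hZ0 : Z ≠ 0 := by
    intro h0
    apply hne
    have hTR : T₀ k ∈ R := ⟨⟨T₀, hT₀⟩, rfl⟩
    rw [← Submodule.starProjection_eq_self_iff.2 hTR, Submodule.inner_starProjection_left_eq_right]
    have h1 : R.starProjection (Y ξ₀) = 0 := DFunLike.congr_fun h0 ξ₀
    rw [h1, inner_zero_right]
  obtain ⟨c, U, hU, hUρ⟩ := hπ'.exists_isometry_of_intertwiner Z hZ hZ0
  have hUR : ∀ x, U x ∈ R := fun x => by
    rw [hU]
    exact R.smul_mem _ (Submodule.starProjection_apply_mem _ _)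
  -- `τ ξ` is the intertwiner whose value at `k` is `U ξ`; the factorization is then `ξ ⊗ η ↦ (τ ξ)
  -- η`.
  let τ : K' →ₗ[ℂ] N := (LinearEquiv.ofInjective ev.toLinearMap ev.injective).symm.toLinearMap ∘ₗ
    U.toLinearMap.codRestrict R hUR
  have hτ : ∀ ξ, (τ ξ : K →L[ℂ] H) k = U ξ := fun ξ =>
    congrArg Subtype.val ((LinearEquiv.ofInjective ev.toLinearMap ev.injective).apply_symm_apply
      (⟨U ξ, hUR ξ⟩ : R))
  have hτρ : ∀ b ξ, (τ (π' b ξ) : K →L[ℂ] H) = ρ b ∘L (τ ξ : K →L[ℂ] H) := by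
    intro b ξ
    have h1 : τ (π' b ξ) = ⟨ρ b ∘L (τ ξ : K →L[ℂ] H), hρN b _ (τ ξ).2⟩ := by
      apply ev.injective
      change (τ (π' b ξ) : K →L[ℂ] H) k = ρ b ((τ ξ : K →L[ℂ] H) k)
      rw [hτ, hτ, hUρ]
    exact congrArg Subtype.val h1
  obtain ⟨J, hJ⟩ := exists_isometry_hilbertTensor (LinearMap.mk₂ ℂ
    (fun (ξ : K') (η : K) => (τ ξ : K →L[ℂ] H) η)
    (fun ξ ξ' η => by rw [map_add]; rfl) (fun c ξ η => by rw [map_smul]; rfl)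
    (fun ξ η η' => map_add _ _ _) (fun c ξ η => map_smul _ _ _)) (fun ξ ξ' η η' => by
      rw [LinearMap.mk₂_apply, LinearMap.mk₂_apply, inner_intertwiners hπ (τ ξ).2 (τ ξ').2 hk,
        hτ, hτ, U.inner_map_map])
  have hJ : ∀ ξ η, J (hTmul ξ η) = (τ ξ : K →L[ℂ] H) η := hJ
  have hρJ : ∀ b ξ η, J (hTmul (π' b ξ) η) = ρ b (J (hTmul ξ η)) := fun b ξ η => by
    rw [hJ, hJ, hτρ]; rfl
  have hσJ : ∀ c ξ η, J (hTmul ξ (π c η)) = σ c (J (hTmul ξ η)) := fun c ξ η => by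
    rw [hJ, hJ]
    exact (τ ξ).2 c η
  have hclosed : IsClosed (Set.range J) := J.isometry.isClosedEmbedding.isClosed_range
  have hrange : ∀ S : H →L[ℂ] H, (∀ ξ η, S (J (hTmul ξ η)) ∈ Set.range J) →
      ∀ t, S (J t) ∈ Set.range J := fun S hS t =>
    hilbertTensor_induction (p := fun t => S (J t) ∈ Set.range J)
      (hclosed.preimage (by fun_prop)) hS (by
        rintro s t ⟨x, hx⟩ ⟨y, hy⟩
        exact ⟨x + y, by rw [map_add, hx, hy, map_add, map_add]⟩) t
  -- The range of `J` is closed, nonzero and invariant under both representations, so joint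
  -- irreducibility applies.
  have hs : Function.Surjective J := by
    rcases hirr (LinearMap.range J.toLinearMap) hclosed
      (by rintro b _ ⟨t, rfl⟩; exact hrange _ (fun ξ η => ⟨_, hρJ b ξ η⟩) t)
      (by rintro c _ ⟨t, rfl⟩; exact hrange _ (fun ξ η => ⟨_, hσJ c ξ η⟩) t) with h | h
    · exfalso
      obtain ⟨ξ, hξ⟩ := exists_ne (0 : K')
      have h1 : J (hTmul ξ k) ∈ LinearMap.range J.toLinearMap := ⟨_, rfl⟩
      rw [h, Submodule.mem_bot, hJ, hτ] at h1
      exact hξ (U.injective (by rw [h1, map_zero]))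
    · exact LinearMap.range_eq_top.1 h
  exact ⟨LinearIsometryEquiv.ofSurjective J hs, fun b c ξ η => by
    change J (hTmul (π' b ξ) (π c η)) = ρ b (σ c (J (hTmul ξ η)))
    rw [hρJ, hσJ]⟩

end Splitting
/-! ### The quasi-local algebra as a C*-algebra -/

theorem isClosed_regionAlg (d : ℕ) (S : Set ℤ) :
    IsClosed (regionAlg d S : Set (ConfigSpace d →L[ℂ] ConfigSpace d)) :=
  StarSubalgebra.isClosed_topologicalClosure _

/-- The C*-algebra structure of the algebra of a region. It is not an instance, so that the algebraic
structure is always found through `StarSubalgebra`. -/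
noncomputable abbrev regionCStarAlgebra (d : ℕ) (S : Set ℤ) : CStarAlgebra (regionAlg d S) :=
  StarSubalgebra.cstarAlgebra (h_closed := isClosed_regionAlg d S)

theorem continuous_starAlgHom {A B : Type*} [CStarAlgebra A] [CStarAlgebra B] (f : A →⋆ₐ[ℂ] B) :
    Continuous f :=
  AddMonoidHomClass.continuous_of_bound f 1 fun x => by
    rw [one_mul]
    exact NonUnitalStarAlgHom.norm_apply_le f x

theorem isGNSTriple_gnsStarAlgHom {A : Type*} [CStarAlgebra A] [PartialOrder A] [StarOrderedRing A]
    (f : A →ₚ[ℂ] ℂ) :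
    IsGNSTriple (f : A →ₗ[ℂ] ℂ) f.gnsStarAlgHom ((f.toPreGNS 1 : f.PreGNS) : f.GNS) := by
  have h : ∀ a, f.gnsStarAlgHom a ((f.toPreGNS 1 : f.PreGNS) : f.GNS)
      = ((f.toPreGNS a : f.PreGNS) : f.GNS) := fun a => by simp
  refine ⟨?_, fun a => ?_⟩
  · have hd : DenseRange ((↑) : f.PreGNS → f.GNS) := UniformSpace.Completion.denseRange_coe
    refine hd.mono ?_
    rintro _ ⟨a, rfl⟩
    exact ⟨f.ofPreGNS a, h _⟩
  · rw [h, UniformSpace.Completion.inner_coe, PositiveLinearMap.preGNS_inner_def]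
    simp

theorem IsState.exists_isGNSTriple {A : Type u} [CStarAlgebra A] {φ : A →ₗ[ℂ] ℂ}
    (hφ : IsState φ) :
    ∃ (H : Type u) (_ : NormedAddCommGroup H) (_ : InnerProductSpace ℂ H) (_ : CompleteSpace H)
      (π : A →⋆ₐ[ℂ] (H →L[ℂ] H)) (Ω : H), IsGNSTriple φ π Ω := by
  let _ : PartialOrder A := CStarAlgebra.spectralOrder A
  have : StarOrderedRing A := CStarAlgebra.spectralOrderedRing A
  exact ⟨_, _, _, inferInstance, _, _, isGNSTriple_gnsStarAlgHom (PositiveLinearMap.mk₀ φ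
    fun a ha => by
      obtain ⟨b, rfl⟩ := CStarAlgebra.nonneg_iff_eq_star_mul_self.1 ha
      exact hφ.nonneg b)⟩

theorem star_matrixUnit {d : ℕ} (j : ℤ) (μ ν : Fin d) :
    star (matrixUnit j μ ν) = matrixUnit j ν μ := by
  rw [ContinuousLinearMap.star_eq_adjoint, eq_comm, ContinuousLinearMap.eq_adjoint_iff]
  intro f g
  rw [lp.inner_eq_tsum, lp.inner_eq_tsum]
  simp only [matrixUnit_apply]
  have hsupp : ∀ s : Config d, ⟪f s, if s j = μ then g (Function.update s j ν) else 0⟫_ℂ ≠ 0 →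
      s j = μ := by
    intro s hs
    by_contra h
    exact hs (by rw [if_neg h, inner_zero_right])
  -- Nonzero terms on one side have `s j = μ`, on the other `s j = ν`; changing the entry at `j`
  -- matches them.
  refine tsum_eq_tsum_of_ne_zero_bij (fun s => Function.update s.1 j ν) ?_ ?_ ?_
  · rintro ⟨s, hs⟩ ⟨t, ht⟩ h
    refine Subtype.ext (funext fun k => ?_)
    by_cases hk : k = j
    · rw [hk]
      exact (hsupp s hs).trans (hsupp t ht).symm
    · simpa [hk] using congrFun h k
  · intro s hs
    have hsj : s j = ν := by
      by_contra h
      exact hs (by simp [h])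
    have hne : ⟪f (Function.update s j μ), g s⟫_ℂ ≠ 0 := by
      intro h
      refine hs ?_
      change ⟪if s j = ν then f (Function.update s j μ) else 0, g s⟫_ℂ = 0
      rw [if_pos hsj, h]
    have hs' : Function.update s j ν = s := by rw [← hsj, Function.update_eq_self]
    refine ⟨⟨Function.update s j μ, ?_⟩, ?_⟩
    · simpa [hs'] using hne
    · simp [hs']
  · rintro ⟨s, hs⟩
    have h := hsupp s hs
    have hs' : Function.update s j μ = s := by rw [← h, Function.update_eq_self]
    simp [h, hs']

theorem star_site {d : ℕ} (j : ℤ) (Q : Matrix (Fin d) (Fin d) ℂ) :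
    star (site j Q) = site j (star Q) := by
  simp only [site, star_sum, star_smul, star_matrixUnit, Matrix.star_apply]
  exact Finset.sum_comm

theorem commute_site {d : ℕ} {i j : ℤ} (hij : i ≠ j) (P Q : Matrix (Fin d) (Fin d) ℂ) :
    Commute (site i P) (site j Q) := by
  ext f s
  change site i P (site j Q f) s = site j Q (site i P f) s
  simp only [site_apply, Finset.mul_sum]
  rw [Finset.sum_comm]
  refine Finset.sum_congr rfl fun ν _ => Finset.sum_congr rfl fun μ _ => ?_
  rw [Function.update_of_ne hij.symm, Function.update_of_ne hij, Function.update_comm hij.symm,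
    mul_left_comm]

theorem regionAlg_le {d : ℕ} {S : Set ℤ} {M : StarSubalgebra ℂ (ConfigSpace d →L[ℂ] ConfigSpace d)}
    (hM : IsClosed (M : Set (ConfigSpace d →L[ℂ] ConfigSpace d)))
    (h : ∀ j ∈ S, ∀ Q, site j Q ∈ M) : regionAlg d S ≤ M :=
  StarSubalgebra.topologicalClosure_minimal (StarAlgebra.adjoin_le (by
    rintro _ ⟨j, hj, Q, rfl⟩
    exact h j hj Q)) hM

theorem isClosed_centralizer_starSubalgebra {d : ℕ} (s : Set (ConfigSpace d →L[ℂ] ConfigSpace d)) :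
    IsClosed (StarSubalgebra.centralizer ℂ s : Set (ConfigSpace d →L[ℂ] ConfigSpace d)) := by
  rw [StarSubalgebra.coe_centralizer]
  exact Set.isClosed_centralizer _

/-- Observables of disjoint regions commute. -/
theorem commute_regionAlg {d : ℕ} {S T : Set ℤ} (hST : Disjoint S T)
    {x y : ConfigSpace d →L[ℂ] ConfigSpace d} (hx : x ∈ regionAlg d S) (hy : y ∈ regionAlg d T) :
    x * y = y * x := by
  have h1 : ∀ j ∈ T, ∀ Q, ∀ x ∈ regionAlg d S, site j Q * x = x * site j Q := by
    intro j hj Q x hx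
    have hle : regionAlg d S ≤ StarSubalgebra.centralizer ℂ {site j Q} :=
      regionAlg_le (isClosed_centralizer_starSubalgebra _) fun i hi P => by
        have hij : j ≠ i := fun h => Set.disjoint_left.1 hST hi (h ▸ hj)
        refine (StarSubalgebra.mem_centralizer_iff ℂ).2 ?_
        rintro _ rfl
        rw [star_site]
        exact ⟨commute_site hij _ _, commute_site hij _ _⟩
    exact ((StarSubalgebra.mem_centralizer_iff ℂ).1 (hle hx) _ rfl).1
  have hle : regionAlg d T ≤ StarSubalgebra.centralizer ℂ {x} :=
    regionAlg_le (isClosed_centralizer_starSubalgebra _) fun j hj Q => by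
      refine (StarSubalgebra.mem_centralizer_iff ℂ).2 ?_
      rintro _ rfl
      exact ⟨(h1 j hj Q _ hx).symm, (h1 j hj Q _ (star_mem hx)).symm⟩
  exact ((StarSubalgebra.mem_centralizer_iff ℂ).1 (hle hy) _ rfl).1

theorem coe_inclusion {B : Type*} [Ring B] [StarRing B] [Algebra ℂ B] [StarModule ℂ B]
    {S T : StarSubalgebra ℂ B} (h : S ≤ T) (x : S) : (StarSubalgebra.inclusion h x : B) = x := rfl

theorem coe_inclL {d : ℕ} (a : LeftChain d) :
    ((inclL a : Chain d) : ConfigSpace d →L[ℂ] ConfigSpace d) = a :=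
  coe_inclusion (regionAlg_mono (Set.subset_univ _)) a

theorem coe_inclR {d : ℕ} (b : RightChain d) :
    ((inclR b : Chain d) : ConfigSpace d →L[ℂ] ConfigSpace d) = b :=
  coe_inclusion (regionAlg_mono (Set.subset_univ _)) b

theorem disjoint_left_right : Disjoint {j : ℤ | j ≤ -1} {j : ℤ | 0 ≤ j} :=
  Set.disjoint_left.2 fun j (h : j ≤ -1) (h' : 0 ≤ j) => by omega

theorem inclL_mul_inclR {d : ℕ} (a : LeftChain d) (b : RightChain d) :
    inclL a * inclR b = inclR b * inclL a := by
  have h := commute_regionAlg disjoint_left_right a.2 b.2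
  refine Subtype.ext ?_
  rw [MulMemClass.coe_mul, MulMemClass.coe_mul, coe_inclL, coe_inclR]
  exact h

theorem continuous_regionAlg_hom {d : ℕ} {S : Set ℤ} {B : Type*} [CStarAlgebra B]
    (f : regionAlg d S →⋆ₐ[ℂ] B) : Continuous f :=
  letI := regionCStarAlgebra d S
  continuous_starAlgHom f

theorem exists_isGNSTriple_chain {d : ℕ} {φ : Chain d →ₗ[ℂ] ℂ} (hφ : IsState φ) :
    ∃ (H : Type) (_ : NormedAddCommGroup H) (_ : InnerProductSpace ℂ H) (_ : CompleteSpace H)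
      (π : Chain d →⋆ₐ[ℂ] (H →L[ℂ] H)) (Ω : H), IsGNSTriple φ π Ω :=
  letI := regionCStarAlgebra d Set.univ
  IsState.exists_isGNSTriple hφ

/-- A *-homomorphism on the algebra of a region is determined by its values on the one-site
observables. -/
theorem regionAlg_hom_ext {d : ℕ} {S : Set ℤ} {B : Type*} [CStarAlgebra B]
    {f g : regionAlg d S →⋆ₐ[ℂ] B}
    (h : ∀ j (hj : j ∈ S) Q, f ⟨site j Q, site_mem hj Q⟩ = g ⟨site j Q, site_mem hj Q⟩) :
    f = g := by
  have hc : IsClosed {x | f x = g x} :=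
    isClosed_eq (continuous_regionAlg_hom f) (continuous_regionAlg_hom g)
  -- The equalizer is pushed forward to the bounded operators, where it is a closed *-subalgebra
  -- containing all generators.
  let M := (StarAlgHom.equalizer f g).map (regionAlg d S).subtype
  have hM : IsClosed (M : Set (ConfigSpace d →L[ℂ] ConfigSpace d)) :=
    (isClosed_regionAlg d S).isClosedEmbedding_subtypeVal.isClosedMap _ hc
  have hle : regionAlg d S ≤ M := regionAlg_le hM fun j hj Q => ⟨_, h j hj Q, rfl⟩
  refine StarAlgHom.ext fun x => ?_
  obtain ⟨y, hy, hyx⟩ := hle x.2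
  rw [← Subtype.ext hyx]
  exact hy

/-- A *-homomorphism on `𝒜` is determined by its restrictions to `𝒜_L` and `𝒜_R`. -/
theorem chain_hom_ext {d : ℕ} {B : Type*} [CStarAlgebra B] {f g : Chain d →⋆ₐ[ℂ] B}
    (hL : ∀ a, f (inclL a) = g (inclL a)) (hR : ∀ b, f (inclR b) = g (inclR b)) : f = g := by
  refine regionAlg_hom_ext fun j _ Q => ?_
  rcases lt_or_ge j 0 with hj | hj
  · exact hL ⟨site j Q, site_mem (S := {j | j ≤ -1}) (show j ≤ -1 by omega) Q⟩
  · exact hR ⟨site j Q, site_mem (S := {j | 0 ≤ j}) hj Q⟩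

theorem γ_γ {d : ℕ} (A : Chain d) : γ d (γ d A) = A :=
  Subtype.ext (reflectionAd_reflectionAd _)

theorem γLR_γRL {d : ℕ} (b : RightChain d) : γLR d (γRL d b) = b :=
  Subtype.ext (reflectionAd_reflectionAd _)

/-- A unitary that intertwines two representations of `𝒜` on `𝒜_L` and on `𝒜_R` intertwines
them. -/
theorem intertwines_of_inclL_inclR {d : ℕ} {H : Type*} [NormedAddCommGroup H]
    [InnerProductSpace ℂ H] [CompleteSpace H] {H' : Type*} [NormedAddCommGroup H']
    [InnerProductSpace ℂ H'] [CompleteSpace H'] {π : Chain d →⋆ₐ[ℂ] (H →L[ℂ] H)}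
    {π' : Chain d →⋆ₐ[ℂ] (H' →L[ℂ] H')} (U : H ≃ₗᵢ[ℂ] H')
    (hL : ∀ a x, U (π (inclL a) x) = π' (inclL a) (U x))
    (hR : ∀ b x, U (π (inclR b) x) = π' (inclR b) (U x)) (A : Chain d) (x : H) :
    U (π A x) = π' A (U x) := by
  have h : (U.conjStarAlgEquiv : (H →L[ℂ] H) →⋆ₐ[ℂ] (H' →L[ℂ] H')).comp π = π' := by
    refine chain_hom_ext (fun a => ?_) (fun b => ?_)
    · ext y
      change U (π (inclL a) (U.symm y)) = _
      rw [hL, U.apply_symm_apply]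
    · ext y
      change U (π (inclR b) (U.symm y)) = _
      rw [hR, U.apply_symm_apply]
  rw [← h]
  change U (π A x) = U (π A (U.symm (U x)))
  rw [U.symm_apply_apply]

/-- The orthogonal reflection in `L` is a unitary commuting with both halves, hence with all of the
representation; `L` is its fixed space. -/
theorem invariant_of_inclL_inclR {d : ℕ} {H : Type*} [NormedAddCommGroup H]
    [InnerProductSpace ℂ H] [CompleteSpace H] {π : Chain d →⋆ₐ[ℂ] (H →L[ℂ] H)}
    {L : Submodule ℂ H} (hclosed : IsClosed (L : Set H))
    (hL : ∀ a, ∀ x ∈ L, π (inclL a) x ∈ L) (hR : ∀ b, ∀ x ∈ L, π (inclR b) x ∈ L)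
    (A : Chain d) {x : H} (hx : x ∈ L) : π A x ∈ L := by
  have : CompleteSpace L := hclosed.completeSpace_coe
  have hPL := starProjection_rep (π := π.comp inclL) hL
  have hPR := starProjection_rep (π := π.comp inclR) hR
  have h := intertwines_of_inclL_inclR (π := π) (π' := π) L.reflection
    (fun a y => by
      simp only [Submodule.reflection_apply, map_sub]
      rw [show L.starProjection (π (inclL a) y) = π (inclL a) (L.starProjection y) from hPL a y]
      simp [two_smul])
    (fun b y => by
      simp only [Submodule.reflection_apply, map_sub]
      rw [show L.starProjection (π (inclR b) y) = π (inclR b) (L.starProjection y) from hPR b y]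
      simp [two_smul]) A x
  rw [L.reflection_eq_self_iff x |>.2 hx] at h
  exact (L.reflection_eq_self_iff _).1 h

/-! ### Reflection-split representations -/

theorem IsIrreducibleRep.comp_surjective {A B : Type*} [Ring A] [StarRing A] [Algebra ℂ A]
    [Ring B] [StarRing B] [Algebra ℂ B] {H : Type*} [NormedAddCommGroup H]
    [InnerProductSpace ℂ H] [CompleteSpace H] {π : A →⋆ₐ[ℂ] (H →L[ℂ] H)}
    (h : IsIrreducibleRep π) {f : B →⋆ₐ[ℂ] A} (hf : Function.Surjective f) :
    IsIrreducibleRep (π.comp f) :=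
  ⟨h.1, fun K hK hinv => h.2 K hK fun a x hx => by
    obtain ⟨b, rfl⟩ := hf a
    exact hinv b x hx⟩

theorem IsGNSTriple.comp_surjective {A B : Type*} [Ring A] [StarRing A] [Algebra ℂ A]
    [Ring B] [StarRing B] [Algebra ℂ B] {H : Type*} [NormedAddCommGroup H]
    [InnerProductSpace ℂ H] [CompleteSpace H] {φ : A →ₗ[ℂ] ℂ} {π : A →⋆ₐ[ℂ] (H →L[ℂ] H)} {Ω : H}
    (h : IsGNSTriple φ π Ω) {f : B →⋆ₐ[ℂ] A} (hf : Function.Surjective f) {ψ : B →ₗ[ℂ] ℂ}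
    (hψ : ∀ b, ψ b = φ (f b)) : IsGNSTriple ψ (π.comp f) Ω where
  cyclic := h.cyclic.mono (by
    rintro _ ⟨a, rfl⟩
    obtain ⟨b, rfl⟩ := hf a
    exact ⟨b, rfl⟩)
  eq_inner b := (hψ b).trans (h.eq_inner (f b))

section

variable {d : ℕ} {ω : Chain d →ₗ[ℂ] ℂ} {H : Type*} [NormedAddCommGroup H]
  [InnerProductSpace ℂ H] [CompleteSpace H]

theorem IsTensorRep.apply_inclL {K : Type*} [NormedAddCommGroup K] [InnerProductSpace ℂ K]
    [CompleteSpace K] {τ : Chain d →⋆ₐ[ℂ] (HilbertTensor H K →L[ℂ] HilbertTensor H K)}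
    {ρ : LeftChain d →⋆ₐ[ℂ] (H →L[ℂ] H)} {π : RightChain d →⋆ₐ[ℂ] (K →L[ℂ] K)}
    (h : IsTensorRep τ ρ π) (a : LeftChain d) (ξ : H) (η : K) :
    τ (inclL a) (hTmul ξ η) = hTmul (ρ a ξ) η := by
  have := h a 1 ξ η
  rwa [map_one, mul_one, rep_one_apply] at this

theorem IsTensorRep.apply_inclR {K : Type*} [NormedAddCommGroup K] [InnerProductSpace ℂ K]
    [CompleteSpace K] {τ : Chain d →⋆ₐ[ℂ] (HilbertTensor H K →L[ℂ] HilbertTensor H K)}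
    {ρ : LeftChain d →⋆ₐ[ℂ] (H →L[ℂ] H)} {π : RightChain d →⋆ₐ[ℂ] (K →L[ℂ] K)}
    (h : IsTensorRep τ ρ π) (b : RightChain d) (ξ : H) (η : K) :
    τ (inclR b) (hTmul ξ η) = hTmul ξ (π b η) := by
  have := h 1 b ξ η
  rwa [map_one, one_mul, rep_one_apply] at this

/-- The unitary implementing the reflection in a GNS representation. -/
theorem IsGNSTriple.exists_reflection_unitary (hω : IsReflectionInvariant ω)
    {π : Chain d →⋆ₐ[ℂ] (H →L[ℂ] H)} {Ω : H} (h : IsGNSTriple ω π Ω) :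
    ∃ Γ : H ≃ₗᵢ[ℂ] H, (∀ A, Γ (π A Ω) = π (γ d A) Ω) ∧ ∀ A x, Γ (π A x) = π (γ d A) (Γ x) :=
  h.exists_unitary (h.comp_surjective (f := (γ d).toStarAlgHom) (γ d).surjective
    fun A => (hω A).symm)

/-- The GNS representation of the restricted state embeds in `ϖ ∘ inclR`, and with it the
irreducible `π`. Conjugation by the reflection unitary supplies the matching copy of `π ∘ γLR` on
the left, so both tensor factors are the same space `K`. -/
theorem exists_reflectionSplitRep (hpure : IsPureState ω) (hrefl : IsReflectionInvariant ω)
    (hsplit : HasSplitProperty ω) :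
    ∃ (K : Type) (_ : NormedAddCommGroup K) (_ : InnerProductSpace ℂ K) (_ : CompleteSpace K),
      Nonempty (ReflectionSplitRep ω K) := by
  have hstate : IsState ω := hpure.1
  obtain ⟨G, _, _, _, ϖ, Ω, hϖ⟩ := exists_isGNSTriple_chain hstate
  obtain ⟨HR, _, _, _, πR, ΩR, hgR, htype⟩ := hsplit
  obtain ⟨K, _, _, _, π, V₀, hirr, hV₀⟩ := exists_irreducible_of_isTypeIFactor htype
  obtain ⟨V₁, -, hV₁⟩ := hgR.exists_isometry (π' := ϖ.comp inclR) (Ω' := Ω)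
    fun b => hϖ.eq_inner (inclR b)
  obtain ⟨Γ₀, -, hΓ₀⟩ := hϖ.exists_reflection_unitary hrefl
  have hϖirr := hpure.isIrreducibleRep hϖ
  let V : K →ₗᵢ[ℂ] G := V₁.comp V₀
  have hV : ∀ b x, V (π b x) = ϖ (inclR b) (V x) := fun b x => by
    change V₁ (V₀ (π b x)) = ϖ (inclR b) (V₁ (V₀ x))
    rw [hV₀, hV₁]
    rfl
  have hY : ∀ a x, Γ₀ (V (π (γLR d a) x)) = ϖ (inclL a) (Γ₀ (V x)) := fun a x => by
    rw [hV, hΓ₀, ← γ_inclL, γ_γ]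
  obtain ⟨J, hJ⟩ := exists_tensor_unitary (ρ := ϖ.comp inclL) (σ := ϖ.comp inclR)
    (fun a b x => by
      change ϖ (inclL a) (ϖ (inclR b) x) = ϖ (inclR b) (ϖ (inclL a) x)
      rw [← rep_mul_apply, inclL_mul_inclR, rep_mul_apply])
    (fun L hL h1 h2 => hϖirr.2 L hL fun A x hx => invariant_of_inclL_inclR hL h1 h2 A hx)
    hirr V hV (π' := π.comp (γLR d).toStarAlgHom) (hirr.comp_surjective (γLR d).surjective)
    (Γ₀.toLinearIsometry.comp V) hY
  let πhat : Chain d →⋆ₐ[ℂ] (HilbertTensor K K →L[ℂ] HilbertTensor K K) :=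
    (J.symm.conjStarAlgEquiv : (G →L[ℂ] G) →⋆ₐ[ℂ] _).comp ϖ
  have hπhat : ∀ A t, πhat A t = J.symm (ϖ A (J t)) := fun A t => rfl
  have htensor : IsTensorRep πhat (π.comp (γLR d).toStarAlgHom) π := by
    intro a b ξ η
    rw [hπhat, rep_mul_apply, J.symm_apply_eq]
    exact (hJ a b ξ η).symm
  have hgns : IsGNSTriple ω πhat (J.symm Ω) := by
    refine ⟨?_, fun A => ?_⟩
    · have h := J.symm.surjective.denseRange.dense_image J.symm.continuous hϖ.cyclic
      refine h.mono ?_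
      rintro _ ⟨_, ⟨A, rfl⟩, rfl⟩
      exact ⟨A, by simp [hπhat]⟩
    · rw [hπhat, J.symm.inner_map_map, J.apply_symm_apply]
      exact hϖ.eq_inner A
  obtain ⟨Γ, hΓ, -⟩ := hgns.exists_reflection_unitary hrefl
  exact ⟨K, _, _, _, ⟨⟨π, πhat, J.symm Ω, Γ, htensor, hirr, hgns.norm_eq_one hstate.map_one, hgns,
    hΓ⟩⟩⟩

/-! ### The reflection unitary as a signed flip, and uniqueness of the sign -/

namespace ReflectionSplitRep

theorem Γ_rep (r : ReflectionSplitRep ω H) (A : Chain d) (x : HilbertTensor H H) :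
    r.Γ (r.πhat A x) = r.πhat (γ d A) (r.Γ x) := by
  refine r.gns.denseRange.induction_on x (isClosed_eq (by fun_prop) (by fun_prop)) fun B => ?_
  rw [orbitMap_apply, ← rep_mul_apply, r.Γ_apply, r.Γ_apply, map_mul, rep_mul_apply]

theorem Γ_Γ (r : ReflectionSplitRep ω H) (x : HilbertTensor H H) : r.Γ (r.Γ x) = x := by
  refine r.gns.denseRange.induction_on x (isClosed_eq (by fun_prop) (by fun_prop)) fun B => ?_
  rw [orbitMap_apply, r.Γ_apply, r.Γ_apply, γ_γ]

/-- Exchanging the factors turns `π ∘ γLR` on the left into `π` on the right, so the flip implements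
`γ` just as `Γ` does. -/
theorem flip_rep (r : ReflectionSplitRep ω H) (F : HilbertTensor H H ≃ₗᵢ[ℂ] HilbertTensor H H)
    (hF : ∀ ξ η, F (hTmul ξ η) = hTmul η ξ) (A : Chain d) (x : HilbertTensor H H) :
    F (r.πhat A x) = r.πhat (γ d A) (F x) := by
  refine intertwines_of_inclL_inclR (π := r.πhat) (π' := r.πhat.comp (γ d).toStarAlgHom) F ?_ ?_ A x
  · intro a x
    refine hilbertTensor_induction
      (p := fun x => F (r.πhat (inclL a) x) = r.πhat (γ d (inclL a)) (F x))
      (isClosed_eq (by fun_prop) (by fun_prop)) (fun ξ η => ?_)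
      (fun s t hs ht => by simp only [map_add, hs, ht]) x
    rw [γ_inclL, r.isTensorRep.apply_inclL, hF, hF, r.isTensorRep.apply_inclR]
    rfl
  · intro b x
    refine hilbertTensor_induction
      (p := fun x => F (r.πhat (inclR b) x) = r.πhat (γ d (inclR b)) (F x))
      (isClosed_eq (by fun_prop) (by fun_prop)) (fun ξ η => ?_)
      (fun s t hs ht => by simp only [map_add, hs, ht]) x
    rw [γ_inclR, r.isTensorRep.apply_inclR, hF, hF, r.isTensorRep.apply_inclL]
    change _ = hTmul (r.π (γLR d (γRL d b)) η) ξ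
    rw [γLR_γRL]

/-- The reflection unitary is the flip up to a sign. -/
theorem exists_hasSign (hω : IsPureState ω) (r : ReflectionSplitRep ω H) :
    ∃ σ : ℤˣ, r.HasSign σ := by
  obtain ⟨F, hF⟩ := exists_flip H H
  have hFF : ∀ x, F (F x) = x := fun x =>
    hilbertTensor_induction (p := fun x => F (F x) = x) (isClosed_eq (by fun_prop) (by fun_prop))
      (fun ξ η => by rw [hF, hF]) (fun s t hs ht => by simp only [map_add, hs, ht]) x
  have hirr := hω.isIrreducibleRep r.gns
  obtain ⟨c, hc⟩ := hirr.exists_eq_smul_one (r.Γ.trans F).toLinearIsometry.toContinuousLinearMap (by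
      intro A
      ext x
      change F (r.Γ (r.πhat A x)) = r.πhat A (F (r.Γ x))
      rw [r.Γ_rep, r.flip_rep F hF, γ_γ])
  have hΓ : ∀ x, r.Γ x = c • F x := by
    intro x
    have h1 : F (r.Γ x) = c • x := DFunLike.congr_fun hc x
    rw [← hFF (r.Γ x), h1, map_smul]
  have := hirr.1
  obtain ⟨x, hx⟩ := exists_ne (0 : HilbertTensor H H)
  have hcc : c * c = 1 := by
    have h1 := r.Γ_Γ x
    rw [hΓ, hΓ, map_smul, hFF, smul_smul] at h1
    exact smul_left_injective ℂ hx (by simpa using h1)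
  rcases mul_self_eq_one_iff.1 hcc with h | h
  · exact ⟨1, fun ξ η => by rw [hΓ, hF, h]; simp⟩
  · exact ⟨-1, fun ξ η => by rw [hΓ, hF, h]; simp⟩

/-- The representations of the half-chain in two reflection-split representations of the same
functional are equivalent. -/
theorem exists_half_unitary {H' : Type*} [NormedAddCommGroup H'] [InnerProductSpace ℂ H']
    [CompleteSpace H'] (r : ReflectionSplitRep ω H) (r' : ReflectionSplitRep ω H')
    (U : HilbertTensor H H ≃ₗᵢ[ℂ] HilbertTensor H' H')
    (hU : ∀ A x, U (r.πhat A x) = r'.πhat A (U x)) :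
    ∃ u : H ≃ₗᵢ[ℂ] H', ∀ b x, u (r.π b x) = r'.π b (u x) := by
  have := r.irreducible.1
  obtain ⟨ξ, ξ', hne⟩ : ∃ (ξ : H) (ξ' : H'), ∃ (η : H) (η' : H'),
      ⟪hTmul ξ' η', U (hTmul ξ η)⟫_ℂ ≠ 0 := by
    by_contra! h
    obtain ⟨ξ, hξ⟩ := exists_ne (0 : H)
    have h1 : ∀ t, ⟪t, U (hTmul ξ ξ)⟫_ℂ = 0 := fun t =>
      hilbertTensor_induction (p := fun t => ⟪t, U (hTmul ξ ξ)⟫_ℂ = 0)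
        (isClosed_eq (by fun_prop) (by fun_prop)) (fun x y => h ξ x ξ y) (fun s t hs ht => by rw [inner_add_left, hs, ht, add_zero]) t
    have h2 : hTmul ξ ξ = 0 := U.injective (by
      rw [inner_self_eq_zero.1 (h1 (U (hTmul ξ ξ))), map_zero])
    have h3 := inner_hTmul ξ ξ ξ ξ
    rw [h2, inner_zero_left] at h3
    exact mul_self_ne_zero.2 (inner_self_ne_zero.2 hξ) h3.symm
  -- A slice of `U` with the left vectors `ξ`, `ξ'` fixed. The right half-chain acts only on the
  -- second factor, so `T` intertwines `r.π` and `r'.π`.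
  let T : H →L[ℂ] H' := (hTmulL (K := H') ξ').adjoint ∘L
    U.toLinearIsometry.toContinuousLinearMap ∘L hTmulL ξ
  have hTi : ∀ η η', ⟪η', T η⟫_ℂ = ⟪hTmul ξ' η', U (hTmul ξ η)⟫_ℂ := fun η η' =>
    ContinuousLinearMap.adjoint_inner_right (hTmulL ξ') η' (U (hTmul ξ η))
  have hT : ∀ b x, T (r.π b x) = r'.π b (T x) := by
    intro b x
    refine ext_inner_left ℂ fun y => ?_
    rw [← inner_star_rep, hTi, hTi, ← r.isTensorRep.apply_inclR, hU, ← inner_star_rep,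
      ← map_star, r'.isTensorRep.apply_inclR]
  have hT0 : T ≠ 0 := by
    intro h0
    obtain ⟨η, η', hne⟩ := hne
    apply hne
    rw [← hTi, h0, zero_apply, inner_zero_right]
  obtain ⟨c, V, -, hV⟩ := r.irreducible.exists_isometry_of_intertwiner T hT hT0
  exact ⟨LinearIsometryEquiv.ofSurjective V
    (r'.irreducible.surjective_of_range_invariant V fun b x => ⟨_, hV b x⟩), hV⟩

theorem sign_unique (hω : IsPureState ω) {H' : Type*} [NormedAddCommGroup H']
    [InnerProductSpace ℂ H'] [CompleteSpace H'] {r : ReflectionSplitRep ω H}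
    {r' : ReflectionSplitRep ω H'} {σ σ' : ℤˣ} (h : r.HasSign σ) (h' : r'.HasSign σ') :
    σ = σ' := by
  obtain ⟨U, hUΩ, hU⟩ := r.gns.exists_unitary r'.gns
  obtain ⟨u, hu⟩ := r.exists_half_unitary r' U hU
  obtain ⟨w, hw⟩ := exists_tensorMap u u
  have hwπ : ∀ A x, w (r.πhat A x) = r'.πhat A (w x) := by
    refine intertwines_of_inclL_inclR w (fun a x => ?_) (fun b x => ?_)
    · refine hilbertTensor_induction
        (p := fun x => w (r.πhat (inclL a) x) = r'.πhat (inclL a) (w x))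
        (isClosed_eq (by fun_prop) (by fun_prop)) (fun ξ η => ?_)
        (fun s t hs ht => by simp only [map_add, hs, ht]) x
      rw [r.isTensorRep.apply_inclL, hw, hw, r'.isTensorRep.apply_inclL]
      change hTmul (u (r.π (γLR d a) ξ)) _ = hTmul (r'.π (γLR d a) (u ξ)) _
      rw [hu]
    · refine hilbertTensor_induction
        (p := fun x => w (r.πhat (inclR b) x) = r'.πhat (inclR b) (w x))
        (isClosed_eq (by fun_prop) (by fun_prop)) (fun ξ η => ?_)
        (fun s t hs ht => by simp only [map_add, hs, ht]) x
      rw [r.isTensorRep.apply_inclR, hw, hw, r'.isTensorRep.apply_inclR, hu]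
  have hirr := hω.isIrreducibleRep r.gns
  -- `U` and `w = u ⊗ u` intertwine the same irreducible representations, hence differ by a scalar.
  obtain ⟨c, hc⟩ := hirr.exists_eq_smul_one (U.trans w.symm).toLinearIsometry.toContinuousLinearMap
    (by
      intro A
      ext x
      change w.symm (U (r.πhat A x)) = r.πhat A (w.symm (U x))
      rw [w.symm_apply_eq, hwπ, w.apply_symm_apply, hU])
  have hUw : ∀ x, U x = c • w x := fun x => by
    have h1 : w.symm (U x) = c • x := DFunLike.congr_fun hc x
    rw [w.symm_apply_eq.1 h1, map_smul]
  have hΓ : ∀ x, U (r.Γ x) = r'.Γ (U x) := fun x => by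
    refine r.gns.denseRange.induction_on x (isClosed_eq (by fun_prop) (by fun_prop)) fun B => ?_
    rw [orbitMap_apply, r.Γ_apply, hUΩ, hUΩ, r'.Γ_apply]
  have := r.irreducible.1
  obtain ⟨ξ, hξ⟩ := exists_ne (0 : H)
  have hne : U (hTmul ξ ξ) ≠ 0 := by
    intro h0
    have h1 : hTmul ξ ξ = 0 := U.injective (by rw [h0, map_zero])
    have h2 := inner_hTmul ξ ξ ξ ξ
    rw [h1, inner_zero_left] at h2
    exact mul_self_ne_zero.2 (inner_self_ne_zero.2 hξ) h2.symm
  -- The flips fix `ξ ⊗ ξ` and `uξ ⊗ uξ`, so both sides are multiples of `U (ξ ⊗ ξ)`, by `σ` and by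
  -- `σ'`.
  have key := hΓ (hTmul ξ ξ)
  rw [h, map_smul, hUw, hw, map_smul, h', smul_comm c, ← hw, ← hUw] at key
  have h3 : ((σ : ℤ) : ℂ) = ((σ' : ℤ) : ℂ) := smul_left_injective ℂ hne key
  exact Units.ext (by exact_mod_cast h3)

end ReflectionSplitRep

/-! ### Transport along automorphisms, and well-definedness of the index -/

theorem IsTensorAut.comm_γ {δ : Chain d ≃⋆ₐ[ℂ] Chain d} {αR : RightChain d ≃⋆ₐ[ℂ] RightChain d}
    (hδ : IsTensorAut δ (((γLR d).trans αR).trans (γRL d)) αR) (A : Chain d) :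
    γ d (δ A) = δ (γ d A) := by
  have hL : ∀ a, δ (inclL a) = inclL (γRL d (αR (γLR d a))) := fun a => by
    have := hδ a 1
    rwa [map_one, map_one, map_one, mul_one, mul_one] at this
  have hR : ∀ b, δ (inclR b) = inclR (αR b) := fun b => by
    have := hδ 1 b
    rwa [map_one, map_one, map_one, one_mul, one_mul] at this
  have h : (γ d).toStarAlgHom.comp δ.toStarAlgHom = δ.toStarAlgHom.comp (γ d).toStarAlgHom := by
    let _ := regionCStarAlgebra d Set.univ
    refine chain_hom_ext (B := Chain d) (fun a => ?_) (fun b => ?_)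
    · change γ d (δ (inclL a)) = δ (γ d (inclL a))
      rw [hL, γ_inclL, γ_inclL, hR, γLR_γRL]
    · change γ d (δ (inclR b)) = δ (γ d (inclR b))
      rw [hR, γ_inclR, γ_inclR, hL, γLR_γRL]
  exact DFunLike.congr_fun h A

/-- Reflection-split representations are transported by automorphisms with a reflection invariant
decomposition, with the same reflection unitary. -/
theorem ReflectionSplitRep.exists_transport {ω₁ : Chain d →ₗ[ℂ] ℂ} {α : Chain d ≃⋆ₐ[ℂ] Chain d}
    (hα : ∀ A, ω₁ A = ω (α A)) {αR : RightChain d ≃⋆ₐ[ℂ] RightChain d} {W : unitary (Chain d)}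
    (hdec : IsReflectionInvariantDecomposition α αR W) (r : ReflectionSplitRep ω H) :
    ∃ r₁ : ReflectionSplitRep ω₁ H, r₁.Γ = r.Γ := by
  obtain ⟨⟨δ, hδ, hW⟩, hγW⟩ := hdec
  have hαδ : ∀ A, α A = δ (W * A * star (W : Chain d)) := fun A => by
    rw [← hW, δ.apply_symm_apply]
  have hγW' : γ d (star (W : Chain d)) = star (W : Chain d) :=
    ((γ d).map_star' _).trans (congrArg star hγW)
  have hδW : δ (star (W : Chain d)) = star (δ W) := δ.map_star' _
  let πhat := r.πhat.comp δ.toStarAlgHom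
  -- Chosen because `ω₁ A = ω (δ (W A W*))`: the factor `W` moves to the left entry of the inner
  -- product as `δ W*`.
  let Ω := r.πhat (δ (star (W : Chain d))) r.Ω
  have hπ : ∀ A x, πhat A x = r.πhat (δ A) x := fun A x => rfl
  have hπΩ : ∀ A, πhat A Ω = r.πhat (δ (A * star (W : Chain d))) r.Ω := fun A => by
    rw [hπ, ← rep_mul_apply, ← map_mul]
  have hgns : IsGNSTriple ω₁ πhat Ω := by
    refine ⟨r.gns.cyclic.mono ?_, fun A => ?_⟩
    · rintro _ ⟨A, rfl⟩
      refine ⟨δ.symm A * W, ?_⟩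
      change πhat _ Ω = _
      rw [hπΩ, mul_assoc, Unitary.mul_star_self_of_mem W.2, mul_one, δ.apply_symm_apply]
    · rw [hα, hαδ, r.gns.eq_inner, hπΩ, mul_assoc, map_mul, rep_mul_apply, ← inner_star_rep,
        ← hδW]
  have hone : ω₁ 1 = 1 := by
    rw [hα, map_one, r.gns.eq_inner, rep_one_apply, inner_self_eq_norm_sq_to_K, r.norm_Ω]
    simp
  refine ⟨⟨r.π.comp αR.toStarAlgHom, πhat, Ω, r.Γ, ?_, r.irreducible.comp_surjective αR.surjective,
    hgns.norm_eq_one hone, hgns, fun A => ?_⟩, rfl⟩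
  · intro a b ξ η
    rw [hπ, hδ, r.isTensorRep]
    change hTmul (r.π (γLR d (γRL d (αR (γLR d a)))) ξ) _ = _
    rw [γLR_γRL]
    rfl
  · rw [hπΩ, hπΩ, r.Γ_apply, hδ.comm_γ, map_mul, hγW']

end

/-- The existence clause of the index excludes the vacuous case in which every sign would qualify.
-/
theorem IsZ2Index.eq {d : ℕ} {ω : Chain d →ₗ[ℂ] ℂ} (hω : IsPureState ω) {σ τ : ℤˣ}
    (hσ : IsZ2Index.{0} ω σ) (hτ : IsZ2Index.{0} ω τ) : σ = τ := by
  obtain ⟨H, _, _, _, ⟨r⟩⟩ := hσ.1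
  exact ReflectionSplitRep.sign_unique hω (hσ.2 H r) (hτ.2 H r)

/-- A reflection-split representation of a pure state determines its index. -/
theorem ReflectionSplitRep.isZ2Index {d : ℕ} {ω : Chain d →ₗ[ℂ] ℂ} (hω : IsPureState ω)
    {H : Type} [NormedAddCommGroup H] [InnerProductSpace ℂ H] [CompleteSpace H]
    {r : ReflectionSplitRep ω H} {σ : ℤˣ} (h : r.HasSign σ) : IsZ2Index.{u} ω σ := by
  refine ⟨⟨H, _, _, _, ⟨r⟩⟩, fun H' _ _ _ r' => ?_⟩
  obtain ⟨σ', h'⟩ := r'.exists_hasSign hω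
  rwa [sign_unique hω h h']

theorem z2Index_eq {d : ℕ} {ω : Chain d →ₗ[ℂ] ℂ} (hω : IsPureState ω) {σ : ℤˣ}
    (h : IsZ2Index.{0} ω σ) : z2Index ω = σ := by
  have hex : ∃ σ, IsZ2Index.{0} ω σ := ⟨σ, h⟩
  unfold z2Index
  rw [dif_pos hex]
  exact hex.choose_spec.eq hω h

end SpinChain

theorem theorem2p9 {d : ℕ} (hd : 2 ≤ d) (ω₀ ω₁ : SpinChain.Chain d →ₗ[ℂ] ℂ)
    (hpure₀ : SpinChain.IsPureState ω₀) (hrefl₀ : SpinChain.IsReflectionInvariant ω₀)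
    (hsplit₀ : SpinChain.HasSplitProperty ω₀)
    (hpure₁ : SpinChain.IsPureState ω₁) (hrefl₁ : SpinChain.IsReflectionInvariant ω₁)
    (hsplit₁ : SpinChain.HasSplitProperty ω₁)
    (α : SpinChain.Chain d ≃⋆ₐ[ℂ] SpinChain.Chain d) (hα : ∀ A, ω₁ A = ω₀ (α A))
    (αR : SpinChain.RightChain d ≃⋆ₐ[ℂ] SpinChain.RightChain d)
    (W : unitary (SpinChain.Chain d))
    (hdec : SpinChain.IsReflectionInvariantDecomposition α αR W) :
    SpinChain.IsZ2Index.{u} ω₀ (SpinChain.z2Index ω₀) ∧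
      SpinChain.IsZ2Index.{u} ω₁ (SpinChain.z2Index ω₁) ∧
      SpinChain.z2Index ω₀ = SpinChain.z2Index ω₁ := by
  obtain ⟨H, _, _, _, ⟨r₀⟩⟩ := SpinChain.exists_reflectionSplitRep hpure₀ hrefl₀ hsplit₀
  obtain ⟨σ, h₀⟩ := r₀.exists_hasSign hpure₀
  obtain ⟨r₁, hΓ⟩ := r₀.exists_transport hα hdec
  -- The transported representation has the same `Γ` on the same space, so its sign is unchanged.
  have h₁ : r₁.HasSign σ := fun ξ η => by rw [hΓ, h₀]
  rw [SpinChain.z2Index_eq hpure₀ (SpinChain.ReflectionSplitRep.isZ2Index hpure₀ h₀),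
    SpinChain.z2Index_eq hpure₁ (SpinChain.ReflectionSplitRep.isZ2Index hpure₁ h₁)]
  exact ⟨SpinChain.ReflectionSplitRep.isZ2Index hpure₀ h₀,
    SpinChain.ReflectionSplitRep.isZ2Index hpure₁ h₁, rfl⟩
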